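/- A (right) pre-Lie algebra is a vector space with a bilinear product $\curvearrowleft$ such that $(x\curvearrowleft y)\curvearrowleft z-x\curvearrowleft(y\curvearrowleft z)=(x\curvearrowleft z)\curvearrowleft y-x\curvearrowleft(z\curvearrowleft y)$. For a field $K\supseteq\mathbb{Q}$ let $\mathsf{PL}_K=\bigoplus_{n\ge1}\mathsf{PL}_{K,n}$ be the free pre-Lie algebra over $K$ on one generator $\bullet$ (equivalently, the space spanned by rooted trees, with the grafting product), graded so that $\bullet$ has degree $1$, and let $\widehat{\mathsf{PL}}_K=\prod_{n\ge1}\mathsf{PL}_{K,n}$ be its completion. For $A,T\in\widehat{\mathsf{PL}}_K$ and a formal power series $f(x)=\sum_{k\ge0}f_kx^k$ over $K$ put $A\curvearrowleft f(T)=\sum_{k\ge0}f_k\,((A\curvearrowleft T)\curvearrowleft\cdots)\curvearrowleft T$ ($k$ copies of $T$ in the $k$-th term), and for $A=\sum_n A_n$ put $A[q]=\sum_{n\ge1}q^nA_n$. There is a unique $\Omega\in\widehat{\mathsf{PL}}_{\mathbb{Q}}$ with $$\bullet\curvearrowleft\frac{\Omega}{\exp(\Omega)-1}=\Omega,$$ and,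 $q$ being an indeterminate, there is a unique $\Omega_q=\sum_{n\ge1}\Omega_{q,n}\in\widehat{\mathsf{PL}}_{\mathbb{Q}(q)}$ with $$\Omega_q[q]\curvearrowleft(\exp(\Omega)-1)+\Omega_q[q]-\Omega_q=\bullet\curvearrowleft\Omega_q+(q-1)\,\bullet .$$ Let $\operatorname{Dend}$ be the free dendriform algebra over $\mathbb{Q}(q)$ on one generator. Its basis consists of the planar binary trees with at least one vertex. Write $l\vee r$ for the tree with left subtree $l$ and right subtree $r$, each possibly empty; the products are $(l\vee r)\prec s=l\vee(r*s)$ and $t\succ(l\vee r)=(t*l)\vee r$, where $*$ is $\prec+\succ$ and the empty tree is the unit for $*$. Let $\phi:\mathsf{PL}_{\mathbb{Q}(q)}\to\operatorname{Dend}$ be the unique morphism of pre-Lie algebras, for the pre-Lie product $x\curvearrowleft y=y\succ x-x\prec y$ on $\operatorname{Dend}$, that sends $\bullet$ to the planar binary tree with one vertex. Label the leaves of a planar binary tree $t$ with $n$ vertices by $0,1,\dots,n$ from left to right. A descent of $t$ is a label $i$ with $0<i<n$ such that the leaf $i$ is a left child (that is, is oriented like $\backslash$, with the root drawn at the bottom).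 Let $d(t)$ be the number of descents of $t$ and $\operatorname{maj}(t)$ their sum. Let $[n]_q=1+q+\dots+q^{n-1}$, $[n]_q!=[1]_q\cdots[n]_q$ and $\binom{n}{k}_q=\frac{[n]_q!}{[k]_q!\,[n-k]_q!}$. Then for every $n\ge1$ $$\phi(\Omega_{q,n})=\frac{(-1)^{n-1}}{[n]_q}\sum_{\#t=n}(-1)^{d(t)}\binom{n-1}{d(t)}_q^{-1}q^{\operatorname{maj}(t)-\binom{d(t)+1}{2}}\;t,$$ where the sum runs over all planar binary trees $t$ with $n$ vertices. -/

import Mathlib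

noncomputable section

/-! ### Free pre-Lie algebras

Pre-Lie algebras are right pre-Lie algebras (`RightPreLieRing`, `RightPreLieAlgebra`); the pre-Lie
product `x ↶ y` is written `x * y`. -/

namespace FreePreLie

/-- The relation on the free non-associative algebra imposing the right pre-Lie identity
`(a b) c - a (b c) = (a c) b - a (c b)`. -/
inductive Rel (R X : Type*) [CommRing R] :
    FreeNonUnitalNonAssocAlgebra R X → FreeNonUnitalNonAssocAlgebra R X → Prop
  | preLie (a b c : FreeNonUnitalNonAssocAlgebra R X) :
      Rel R X (a * b * c - a * (b * c)) (a * c * b - a * (c * b))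
  | smul (t : R) {a b : FreeNonUnitalNonAssocAlgebra R X} : Rel R X a b → Rel R X (t • a) (t • b)
  | add_right {a b : FreeNonUnitalNonAssocAlgebra R X} (c : FreeNonUnitalNonAssocAlgebra R X) :
      Rel R X a b → Rel R X (a + c) (b + c)
  | mul_left (a : FreeNonUnitalNonAssocAlgebra R X) {b c : FreeNonUnitalNonAssocAlgebra R X} :
      Rel R X b c → Rel R X (a * b) (a * c)
  | mul_right {a b : FreeNonUnitalNonAssocAlgebra R X} (c : FreeNonUnitalNonAssocAlgebra R X) :
      Rel R X a b → Rel R X (a * c) (b * c)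

end FreePreLie

/-- The free (right) pre-Lie algebra over `R` on the set `X`: the quotient of the free
non-associative algebra by the pre-Lie identity. -/
def FreePreLie (R X : Type*) [CommRing R] : Type _ := Quot (FreePreLie.Rel R X)

namespace FreePreLie

section

variable {R X : Type*} [CommRing R]

theorem Rel.addLeft (a : FreeNonUnitalNonAssocAlgebra R X)
    {b c : FreeNonUnitalNonAssocAlgebra R X} (h : Rel R X b c) : Rel R X (a + b) (a + c) := by
  rw [add_comm _ b, add_comm _ c]; exact h.add_right _

theorem Rel.neg {a b : FreeNonUnitalNonAssocAlgebra R X} (h : Rel R X a b) :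
    Rel R X (-a) (-b) := by
  simpa only [neg_one_smul] using h.smul (-1)

theorem Rel.subLeft (a : FreeNonUnitalNonAssocAlgebra R X)
    {b c : FreeNonUnitalNonAssocAlgebra R X} (h : Rel R X b c) : Rel R X (a - b) (a - c) := by
  simpa only [sub_eq_add_neg] using h.neg.addLeft a

theorem Rel.subRight {a b : FreeNonUnitalNonAssocAlgebra R X}
    (c : FreeNonUnitalNonAssocAlgebra R X) (h : Rel R X a b) : Rel R X (a - c) (b - c) := by
  simpa only [sub_eq_add_neg] using h.add_right (-c)

theorem Rel.smulOfTower {S : Type*} [Monoid S] [DistribMulAction S R] [IsScalarTower S R R] (t : S)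
    (a b : FreeNonUnitalNonAssocAlgebra R X) (h : Rel R X a b) : Rel R X (t • a) (t • b) := by
  rw [← smul_one_smul R t a, ← smul_one_smul R t b]
  exact h.smul _

instance {S : Type*} [Monoid S] [DistribMulAction S R] [IsScalarTower S R R] :
    SMul S (FreePreLie R X) where
  smul t := Quot.map (t • ·) (Rel.smulOfTower t)

instance : Zero (FreePreLie R X) where zero := Quot.mk _ 0

instance : Add (FreePreLie R X) where
  add := Quot.map₂ (· + ·) (fun _ _ _ => Rel.addLeft _) fun _ _ _ => Rel.add_right _

instance : Neg (FreePreLie R X) where neg := Quot.map Neg.neg fun _ _ => Rel.neg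

instance : Sub (FreePreLie R X) where
  sub := Quot.map₂ Sub.sub (fun _ _ _ => Rel.subLeft _) fun _ _ _ => Rel.subRight _

instance : Mul (FreePreLie R X) where
  mul := Quot.map₂ (· * ·) (fun _ _ _ => Rel.mul_left _) fun _ _ _ => Rel.mul_right _

instance : AddGroup (FreePreLie R X) :=
  Function.Surjective.addGroup (Quot.mk _) Quot.mk_surjective rfl (fun _ _ => rfl)
    (fun _ => rfl) (fun _ _ => rfl) (fun _ _ => rfl) fun _ _ => rfl

instance : AddCommGroup (FreePreLie R X) where
  add_comm := by
    rintro ⟨a⟩ ⟨b⟩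
    exact congrArg (Quot.mk (Rel R X)) (add_comm a b)

instance : RightPreLieRing (FreePreLie R X) where
  left_distrib := by
    rintro ⟨a⟩ ⟨b⟩ ⟨c⟩
    exact congrArg (Quot.mk (Rel R X)) (mul_add a b c)
  right_distrib := by
    rintro ⟨a⟩ ⟨b⟩ ⟨c⟩
    exact congrArg (Quot.mk (Rel R X)) (add_mul a b c)
  zero_mul := by
    rintro ⟨a⟩
    exact congrArg (Quot.mk (Rel R X)) (zero_mul a)
  mul_zero := by
    rintro ⟨a⟩
    exact congrArg (Quot.mk (Rel R X)) (mul_zero a)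
  assoc_symm' := by
    rintro ⟨a⟩ ⟨b⟩ ⟨c⟩
    exact Quot.sound (Rel.preLie a b c)

/-- `FreePreLie R X` is a pre-Lie algebra over `R`, and over every ring `S` of which `R` is an
algebra. -/
instance {S : Type*} [CommRing S] [Algebra S R] : RightPreLieAlgebra S (FreePreLie R X) where
  one_smul := by
    rintro ⟨a⟩
    exact congrArg (Quot.mk (Rel R X)) (one_smul S a)
  mul_smul := by
    rintro s t ⟨a⟩
    exact congrArg (Quot.mk (Rel R X)) (mul_smul s t a)
  smul_zero := fun s => congrArg (Quot.mk (Rel R X)) (smul_zero s)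
  smul_add := by
    rintro s ⟨a⟩ ⟨b⟩
    exact congrArg (Quot.mk (Rel R X)) (smul_add s a b)
  add_smul := by
    rintro s t ⟨a⟩
    exact congrArg (Quot.mk (Rel R X)) (add_smul s t a)
  zero_smul := by
    rintro ⟨a⟩
    exact congrArg (Quot.mk (Rel R X)) (zero_smul S a)
  smul_assoc := by
    rintro s ⟨a⟩ ⟨b⟩
    exact congrArg (Quot.mk (Rel R X)) (smul_mul_assoc s a b)
  smul_comm := by
    rintro s ⟨a⟩ ⟨b⟩
    exact congrArg (Quot.mk (Rel R X)) (mul_smul_comm s a b).symm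

variable (R) in
/-- The generators of the free pre-Lie algebra. -/
def of (x : X) : FreePreLie R X := Quot.mk _ (FreeNonUnitalNonAssocAlgebra.of R x)

variable (R) in
theorem lift_rel {A : Type*} [RightPreLieRing A] [RightPreLieAlgebra R A] (f : X → A)
    (a b : FreeNonUnitalNonAssocAlgebra R X) (h : Rel R X a b) :
    FreeNonUnitalNonAssocAlgebra.lift R f a = FreeNonUnitalNonAssocAlgebra.lift R f b := by
  induction h with
  | preLie a b c =>
    simpa only [map_sub, map_mul, associator_apply] using RightPreLieRing.assoc_symm
      (FreeNonUnitalNonAssocAlgebra.lift R f a) (FreeNonUnitalNonAssocAlgebra.lift R f b)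
      (FreeNonUnitalNonAssocAlgebra.lift R f c)
  | smul t _ ih => simp only [map_smul, ih]
  | add_right c _ ih => simp only [map_add, ih]
  | mul_left c _ ih => simp only [map_mul, ih]
  | mul_right c _ ih => simp only [map_mul, ih]

variable (R) in
/-- The unique morphism of pre-Lie algebras out of the free one with given values on the
generators. -/
def lift {A : Type*} [RightPreLieRing A] [RightPreLieAlgebra R A] (f : X → A) :
    FreePreLie R X →ₙₐ[R] A where
  toFun c := Quot.liftOn c (FreeNonUnitalNonAssocAlgebra.lift R f) (lift_rel R f)
  map_smul' := by
    rintro t ⟨a⟩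
    exact map_smul (FreeNonUnitalNonAssocAlgebra.lift R f) t a
  map_zero' := map_zero (FreeNonUnitalNonAssocAlgebra.lift R f)
  map_add' := by
    rintro ⟨a⟩ ⟨b⟩
    exact map_add (FreeNonUnitalNonAssocAlgebra.lift R f) a b
  map_mul' := by
    rintro ⟨a⟩ ⟨b⟩
    exact map_mul (FreeNonUnitalNonAssocAlgebra.lift R f) a b

theorem lift_of {A : Type*} [RightPreLieRing A] [RightPreLieAlgebra R A] (f : X → A) (x : X) :
    lift R f (of R x) = f x :=
  FreeNonUnitalNonAssocAlgebra.lift_of_apply R f x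

theorem lift_unique {A : Type*} [RightPreLieRing A] [RightPreLieAlgebra R A] (f : X → A)
    (g : FreePreLie R X →ₙₐ[R] A) (hg : ∀ x, g (of R x) = f x) : g = lift R f := by
  let m : FreeNonUnitalNonAssocAlgebra R X →ₙₐ[R] FreePreLie R X :=
    { toFun := Quot.mk (Rel R X)
      map_smul' := fun _ _ => rfl
      map_zero' := rfl
      map_add' := fun _ _ => rfl
      map_mul' := fun _ _ => rfl }
  have h : g.comp m = FreeNonUnitalNonAssocAlgebra.lift R f := by
    apply FreeNonUnitalNonAssocAlgebra.hom_ext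
    intro x
    exact (hg x).trans (FreeNonUnitalNonAssocAlgebra.lift_of_apply R f x).symm
  ext c
  obtain ⟨a, rfl⟩ := Quot.mk_surjective c
  exact DFunLike.congr_fun h a

end

end FreePreLie

/-! ### The free pre-Lie algebra on one generator and its completion -/

/-- The free pre-Lie algebra on one generator. -/
abbrev PL (R : Type*) [CommRing R] : Type _ := FreePreLie R Unit

namespace PL

variable (R : Type*) [CommRing R]

/-- The homogeneous component of degree `n` of `PL`: the span of the monomials (products, with any
bracketing, of copies of the generator) with `n` factors. -/
def homog (n : ℕ) : Submodule R (PL R) :=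
  Submodule.span R (FreeMagma.lift (FreePreLie.of R (X := Unit)) '' {w | w.length = n})

theorem of_mem_homog : FreePreLie.of R () ∈ homog R 1 :=
  Submodule.subset_span ⟨FreeMagma.of (), rfl, FreeMagma.lift_of _ _⟩

variable {R}

theorem mul_mem_homog {m n : ℕ} {x y : PL R} (hx : x ∈ homog R m) (hy : y ∈ homog R n) :
    x * y ∈ homog R (m + n) := by
  induction hx using Submodule.span_induction with
  | zero => rw [zero_mul]; exact Submodule.zero_mem _
  | add a b _ _ ha hb => rw [add_mul]; exact Submodule.add_mem _ ha hb
  | smul c a _ ha => rw [smul_mul_assoc]; exact Submodule.smul_mem _ _ ha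
  | mem a ha =>
    obtain ⟨v, hv, rfl⟩ := ha
    induction hy using Submodule.span_induction with
    | zero => rw [mul_zero]; exact Submodule.zero_mem _
    | add a b _ _ ha hb => rw [mul_add]; exact Submodule.add_mem _ ha hb
    | smul c a _ ha => rw [mul_smul_comm]; exact Submodule.smul_mem _ _ ha
    | mem b hb =>
      obtain ⟨w, hw, rfl⟩ := hb
      refine Submodule.subset_span ⟨v * w, ?_, map_mul _ v w⟩
      change v.length + w.length = m + n
      rw [hv, hw]

variable (R) in
/-- Extension of scalars from `ℚ` to `R`, the morphism preserving the generator. -/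
def extend [Algebra ℚ R] : PL ℚ →ₙₐ[ℚ] PL R := FreePreLie.lift ℚ (FreePreLie.of R)

theorem extend_mem_homog [Algebra ℚ R] {n : ℕ} {x : PL ℚ} (hx : x ∈ homog ℚ n) :
    extend R x ∈ homog R n := by
  induction hx using Submodule.span_induction with
  | zero => rw [map_zero]; exact Submodule.zero_mem _
  | add a b _ _ ha hb => rw [map_add]; exact Submodule.add_mem _ ha hb
  | smul c a _ ha =>
    have h : extend R (c • a) = algebraMap ℚ R c • extend R a := by
      rw [map_smul]
      generalize extend R a = z
      obtain ⟨z, rfl⟩ := Quot.mk_surjective z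
      exact congrArg (Quot.mk _) (algebraMap_smul R c z).symm
    rw [h]
    exact Submodule.smul_mem _ _ ha
  | mem a ha =>
    obtain ⟨w, hw, rfl⟩ := ha
    refine Submodule.subset_span ⟨w, hw, ?_⟩
    clear hw
    induction w with
    | ih1 x => exact (FreePreLie.lift_of (R := ℚ) (FreePreLie.of R) x).symm
    | ih2 v w hv hw => rw [map_mul, map_mul, map_mul, hv, hw]

end PL

/-- The completion `∏ₙ PLₙ` of `PL`; the component of degree `0` is zero. -/
abbrev PLHat (R : Type*) [CommRing R] : Type _ := (n : ℕ) → PL.homog R n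

namespace PLHat

variable {R : Type*} [CommRing R]

variable (R) in
/-- The generator, as an element of the completion. -/
def gen : PLHat R := Pi.single 1 ⟨FreePreLie.of R (), PL.of_mem_homog R⟩

/-- The pre-Lie product `A ↶ B` on the completion. -/
def graft (A B : PLHat R) : PLHat R := fun n =>
  ⟨∑ p ∈ Finset.HasAntidiagonal.antidiagonal n, (A p.1 : PL R) * (B p.2 : PL R), Submodule.sum_mem _ fun p hp => by
    rw [← Finset.HasAntidiagonal.mem_antidiagonal.mp hp]
    exact PL.mul_mem_homog (A p.1).2 (B p.2).2⟩

/-- The right action `A ↶ f(T)` on the completion of the element `f(T) = ∑ₖ fₖ T⋆ᵏ` of the completed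
enveloping algebra, where `A ↶ T⋆ᵏ = ((A ↶ T) ↶ ⋯) ↶ T`. In degree `n` the terms with `k > n`
vanish, because `T` has no component of degree `0`. -/
def act (A : PLHat R) (f : PowerSeries R) (T : PLHat R) : PLHat R := fun n =>
  ∑ k ∈ Finset.range (n + 1), PowerSeries.coeff k f • ((fun B => graft B T)^[k] A) n

/-- The `q`-shift `A[q] = ∑ₙ qⁿ Aₙ`. -/
def qShift (q : R) (A : PLHat R) : PLHat R := fun n => q ^ n • A n

variable (R) in
/-- Extension of scalars from `ℚ` to `R`. -/
def extend [Algebra ℚ R] (A : PLHat ℚ) : PLHat R := fun n =>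
  ⟨PL.extend R (A n : PL ℚ), PL.extend_mem_homog (A n).2⟩

end PLHat

open PLHat in
/-- The equation `• ↶ (Ω / (exp Ω - 1)) = Ω` defining `Ω`; here `bernoulliPowerSeries` is
`x / (exp x - 1) = ∑ₖ Bₖ xᵏ / k!`. -/
def IsOmega (Ω : PLHat ℚ) : Prop :=
  act (gen ℚ) (bernoulliPowerSeries ℚ) Ω = Ω

open PLHat in
/-- The equation `Ω_q[q] ↶ (exp Ω - 1) + Ω_q[q] - Ω_q = • ↶ Ω_q + (q - 1) •` defining `Ω_q`, over a
field `K` of characteristic zero with a parameter `q`. -/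
def IsOmegaQ {K : Type*} [Field K] [Algebra ℚ K] (q : K) (Ω : PLHat ℚ) (Ωq : PLHat K) : Prop :=
  act (qShift q Ωq) (PowerSeries.exp K - 1) (extend K Ω) + qShift q Ωq - Ωq
    = graft (gen K) Ωq + (q - 1) • gen K

/-! ### The free dendriform algebra on one generator -/

/-- The non-empty planar binary trees: the tree `left ∨ right` has a root vertex and the (possibly
empty) left and right subtrees. -/
@[ext]
structure PBT where
  left : BinaryTree Unit
  right : BinaryTree Unit

namespace PBT

/-- The underlying binary tree, in which `BinaryTree.nil` stands for a leaf. -/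
def toTree (t : PBT) : BinaryTree Unit := .node () t.left t.right

theorem toTree_injective : Function.Injective toTree := by
  rintro ⟨a, b⟩ ⟨c, d⟩ h
  simpa [toTree] using h

/-- The number of (inner) vertices. -/
def deg (t : PBT) : ℕ := t.toTree.numNodes

/-- The finite set of planar binary trees with `n` vertices, for `n ≥ 1`. -/
def ofDeg (n : ℕ) : Finset PBT :=
  (BinaryTree.treesOfNumNodesEq n).preimage toTree toTree_injective.injOn

theorem mem_ofDeg {n : ℕ} {t : PBT} : t ∈ ofDeg n ↔ t.deg = n := by
  simp [ofDeg, deg]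

/-- The orientations of the leaves from left to right, `true` for a leaf that is a left child
(oriented `\`, the root being at the bottom) and `false` for a leaf that is a right child (oriented
`/`). The second argument says whether the tree itself hangs as a left child. -/
def leafSides : BinaryTree Unit → Bool → List Bool
  | .nil, b => [b]
  | .node _ l r, _ => leafSides l true ++ leafSides r false

/-- The orientations of the leaves `0, …, n` of a planar binary tree with `n` vertices. -/
def leaves (t : PBT) : List Bool := leafSides t.left true ++ leafSides t.right false

/-- The descent set: the labels of the `\`-oriented inner leaves. -/
def descents (t : PBT) : Finset ℕ :=
  (Finset.Ioo 0 t.deg).filter fun i => t.leaves[i]? = some true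

/-- The number of descents. -/
def d (t : PBT) : ℕ := t.descents.card

/-- The major index, the sum of the descents. -/
def maj (t : PBT) : ℕ := ∑ i ∈ t.descents, i

/-- The terms of the associative product `t * s` of two possibly empty planar binary trees; the empty
tree is the unit, and `t * s = l ∨ (r * s) + (t * l') ∨ r'` for `t = l ∨ r` and `s = l' ∨ r'`. -/
def star : BinaryTree Unit → BinaryTree Unit → Multiset (BinaryTree Unit)
  | .nil, s => {s}
  | .node _ l r, .nil => {.node () l r}
  | .node _ l r, .node _ l' r' =>
      (star r (.node () l' r')).map (fun u => .node () l u) +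
      (star (.node () l r) l').map (fun u => .node () u r')
termination_by t s => t.numNodes + s.numNodes
decreasing_by all_goals simp [BinaryTree.numNodes]; try omega

/-- The terms of `t ≺ s = l ∨ (r * s)` for `t = l ∨ r`. -/
def prec (t s : PBT) : Multiset PBT := (star t.right s.toTree).map fun u => ⟨t.left, u⟩

/-- The terms of `t ≻ s = (t * l) ∨ r` for `s = l ∨ r`. -/
def succ (t s : PBT) : Multiset PBT := (star t.toTree s.left).map fun u => ⟨u, s.right⟩

theorem star_nil_right (t : BinaryTree Unit) : star t .nil = {t} := by
  cases t <;> simp [star]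

theorem star_nil_left (t : BinaryTree Unit) : star .nil t = {t} := by
  simp [star]

theorem star_toTree (t s : PBT) :
    star t.toTree s.toTree = (prec t s).map toTree + (succ t s).map toTree := by
  simp only [toTree, prec, succ, Multiset.map_map, Function.comp_def]
  rw [star]

theorem star_node (a b c e : BinaryTree Unit) :
    star (.node () a b) (.node () c e) =
      (star b (.node () c e)).map (fun u => .node () a u) +
      (star (.node () a b) c).map (fun u => .node () u e) := by
  rw [star]

theorem star_assoc (x y z : BinaryTree Unit) :
    (star x y).bind (fun w => star w z) = (star y z).bind (fun w => star x w) := by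
  match x, y, z with
  | .nil, y, z =>
    have h := Multiset.bind_singleton (star y z) id
    simp only [id, Multiset.map_id'] at h
    simp [star_nil_left, h]
  | x, .nil, z => simp [star_nil_left, star_nil_right]
  | x, y, .nil =>
    have h := Multiset.bind_singleton (star x y) id
    simp only [id, Multiset.map_id'] at h
    simp [star_nil_right, h]
  | .node () a b, .node () c e, .node () f g =>
    have h1 := congrArg (Multiset.map fun u => BinaryTree.node () a u)
      (star_assoc b (.node () c e) (.node () f g))
    have h2 := congrArg (Multiset.map fun u => BinaryTree.node () u g)
      (star_assoc (.node () a b) (.node () c e) f)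
    have h3 := Multiset.bind_map_comm (star (.node () a b) c) (star e (.node () f g))
      (f := fun w v => BinaryTree.node () w v)
    rw [star_node c e] at h1
    rw [star_node a b] at h2
    simp only [Multiset.add_bind, Multiset.bind_map, Multiset.map_add, Multiset.map_bind] at h1 h2
    rw [star_node a b c e, star_node c e f g]
    simp only [Multiset.add_bind, Multiset.bind_map, star_node, Multiset.bind_add]
    rw [h1, h3, ← h2]
    abel
termination_by x.numNodes + y.numNodes + z.numNodes
decreasing_by all_goals simp [BinaryTree.numNodes]; try omega

theorem prec_prec (x y z : PBT) :
    (prec x y).bind (fun w => prec w z) = (prec y z + succ y z).bind (fun w => prec x w) := by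
  have h := congrArg (Multiset.map fun u => PBT.mk x.left u) (star_assoc x.right y.toTree z.toTree)
  rw [star_toTree y z, ← Multiset.map_add] at h
  simp only [Multiset.map_bind, Multiset.bind_map] at h
  simp only [prec, Multiset.bind_map] at h ⊢
  exact h

theorem succ_prec (x y z : PBT) :
    (succ x y).bind (fun w => prec w z) = (prec y z).bind (fun w => succ x w) := by
  simp only [prec, succ, Multiset.bind_map]
  exact Multiset.bind_map_comm _ _

theorem succ_succ (x y z : PBT) :
    (prec x y + succ x y).bind (fun w => succ w z) = (succ y z).bind (fun w => succ x w) := by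
  have h := congrArg (Multiset.map fun u => PBT.mk u z.right) (star_assoc x.toTree y.toTree z.left)
  rw [star_toTree x y, ← Multiset.map_add] at h
  simp only [Multiset.map_bind, Multiset.bind_map] at h
  simp only [succ, Multiset.bind_map] at h ⊢
  exact h

end PBT

/-- The free dendriform algebra on one generator over `K`, with basis the planar binary trees. -/
def Dend (K : Type*) [CommRing K] : Type _ := PBT →₀ K

namespace Dend

variable {K : Type*} [CommRing K]

instance : AddCommGroup (Dend K) := inferInstanceAs (AddCommGroup (PBT →₀ K))

instance : Module K (Dend K) := inferInstanceAs (Module K (PBT →₀ K))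

variable (K) in
/-- The basis element given by a planar binary tree. -/
def tree (t : PBT) : Dend K := Finsupp.single t (1 : K)

variable (K) in
/-- The sum in `Dend` of a finite family of planar binary trees. -/
def sumTrees (m : Multiset PBT) : Dend K := (m.map (tree K)).sum

variable (K) in
/-- The bilinear map on `Dend` with given values on pairs of trees. -/
def bilin (f : PBT → PBT → Dend K) : Dend K →ₗ[K] Dend K →ₗ[K] Dend K :=
  Finsupp.linearCombination K fun t => (Finsupp.linearCombination K (f t) : Dend K →ₗ[K] Dend K)

variable (K) in
/-- The dendriform product `x ≺ y`. -/
def prec : Dend K →ₗ[K] Dend K →ₗ[K] Dend K := bilin K fun t s => sumTrees K (t.prec s)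

variable (K) in
/-- The dendriform product `x ≻ y`. -/
def succ : Dend K →ₗ[K] Dend K →ₗ[K] Dend K := bilin K fun t s => sumTrees K (t.succ s)

theorem bilin_tree (f : PBT → PBT → Dend K) (t s : PBT) :
    bilin K f (tree K t) (tree K s) = f t s := by
  unfold bilin tree
  erw [Finsupp.linearCombination_single, one_smul, Finsupp.linearCombination_single, one_smul]

theorem induction {p : Dend K → Prop} (zero : p 0) (add : ∀ x y, p x → p y → p (x + y))
    (smul : ∀ (c : K) t, p (c • tree K t)) (x : Dend K) : p x := by
  refine Finsupp.induction_linear (motive := p) x zero add fun t c => ?_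
  have h := smul c t
  unfold tree at h
  erw [Finsupp.smul_single, smul_eq_mul, mul_one] at h
  exact h

theorem bilin_sumTrees_left (f : PBT → PBT → Multiset PBT) (m : Multiset PBT) (s : PBT) :
    bilin K (fun t s => sumTrees K (f t s)) (sumTrees K m) (tree K s)
      = sumTrees K (m.bind fun t => f t s) := by
  induction m using Multiset.induction with
  | empty => simp [sumTrees]
  | cons a m ih =>
    simp only [sumTrees, Multiset.map_cons, Multiset.sum_cons, map_add, LinearMap.add_apply,
      Multiset.cons_bind, Multiset.map_add, Multiset.sum_add, bilin_tree] at ih ⊢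
    rw [ih]

theorem bilin_sumTrees_right (f : PBT → PBT → Multiset PBT) (t : PBT) (m : Multiset PBT) :
    bilin K (fun t s => sumTrees K (f t s)) (tree K t) (sumTrees K m)
      = sumTrees K (m.bind fun s => f t s) := by
  induction m using Multiset.induction with
  | empty => simp [sumTrees]
  | cons a m ih =>
    simp only [sumTrees, Multiset.map_cons, Multiset.sum_cons, map_add,
      Multiset.cons_bind, Multiset.map_add, Multiset.sum_add, bilin_tree] at ih ⊢
    rw [ih]

theorem sumTrees_add (m n : Multiset PBT) :
    sumTrees K (m + n) = sumTrees K m + sumTrees K n := by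
  simp [sumTrees]

/-- The first dendriform axiom. -/
theorem prec_prec (x y z : Dend K) :
    prec K x (prec K y z) + prec K x (succ K y z) = prec K (prec K x y) z := by
  induction x using Dend.induction with
  | zero => simp
  | add a b ha hb => simp only [map_add, LinearMap.add_apply, ← ha, ← hb]; abel
  | smul c t =>
    induction y using Dend.induction with
    | zero => simp
    | add a b ha hb => simp only [map_add, LinearMap.add_apply, ← ha, ← hb]; abel
    | smul e s =>
      induction z using Dend.induction with
      | zero => simp
      | add a b ha hb => simp only [map_add, ← ha, ← hb]; abel
      | smul g u =>
        simp only [map_smul, LinearMap.smul_apply, ← smul_add]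
        congr 3
        simp only [prec, succ, bilin_tree, bilin_sumTrees_left, bilin_sumTrees_right]
        rw [← sumTrees_add, ← Multiset.add_bind, PBT.prec_prec]

/-- The second dendriform axiom. -/
theorem succ_prec (x y z : Dend K) :
    succ K x (prec K y z) = prec K (succ K x y) z := by
  induction x using Dend.induction with
  | zero => simp
  | add a b ha hb => simp only [map_add, LinearMap.add_apply, ha, hb]
  | smul c t =>
    induction y using Dend.induction with
    | zero => simp
    | add a b ha hb => simp only [map_add, LinearMap.add_apply, ha, hb]
    | smul e s =>
      induction z using Dend.induction with
      | zero => simp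
      | add a b ha hb => simp only [map_add, ha, hb]
      | smul g u =>
        simp only [map_smul, LinearMap.smul_apply]
        congr 3
        simp only [prec, succ, bilin_tree, bilin_sumTrees_left, bilin_sumTrees_right]
        rw [PBT.succ_prec]

/-- The third dendriform axiom. -/
theorem succ_succ (x y z : Dend K) :
    succ K x (succ K y z) = succ K (succ K x y) z + succ K (prec K x y) z := by
  induction x using Dend.induction with
  | zero => simp
  | add a b ha hb => simp only [map_add, LinearMap.add_apply, ha, hb]; abel
  | smul c t =>
    induction y using Dend.induction with
    | zero => simp
    | add a b ha hb => simp only [map_add, LinearMap.add_apply, ha, hb]; abel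
    | smul e s =>
      induction z using Dend.induction with
      | zero => simp
      | add a b ha hb => simp only [map_add, ha, hb]; abel
      | smul g u =>
        simp only [map_smul, LinearMap.smul_apply, ← smul_add]
        congr 3
        simp only [prec, succ, bilin_tree, bilin_sumTrees_left, bilin_sumTrees_right]
        rw [← sumTrees_add, ← Multiset.add_bind, add_comm, PBT.succ_succ]

/-- The pre-Lie product `x ↶ y = y ≻ x - x ≺ y` of the dendriform algebra `Dend`. -/
instance : Mul (Dend K) where
  mul x y := succ K y x - prec K x y

theorem mul_def (x y : Dend K) : x * y = succ K y x - prec K x y := rfl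

instance : RightPreLieRing (Dend K) where
  left_distrib x y z := by simp only [mul_def, map_add, LinearMap.add_apply]; abel
  right_distrib x y z := by simp only [mul_def, map_add, LinearMap.add_apply]; abel
  zero_mul x := by simp [mul_def]
  mul_zero x := by simp [mul_def]
  assoc_symm' x y z := by
    change x * y * z - x * (y * z) = x * z * y - x * (z * y)
    simp only [mul_def, map_sub, LinearMap.sub_apply, succ_succ, ← prec_prec, succ_prec]
    abel

instance : RightPreLieAlgebra K (Dend K) where
  smul_assoc c x y := by
    simp only [smul_eq_mul, mul_def, map_smul, LinearMap.smul_apply, smul_sub]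
  smul_comm c x y := by
    simp only [smul_eq_mul, mul_def, map_smul, LinearMap.smul_apply, smul_sub]

end Dend

/-- The morphism `φ` of pre-Lie algebras from `PL` to `Dend` that maps the generator to the planar
binary tree with one vertex. -/
def phi (K : Type*) [CommRing K] : PL K →ₙₐ[K] Dend K :=
  FreePreLie.lift K fun _ => Dend.tree K ⟨.nil, .nil⟩

/-! ### `q`-analogues -/

/-- The `q`-integer `[n]_q = 1 + q + ⋯ + q ^ (n - 1)`. -/
def qInt {K : Type*} [Field K] (q : K) (n : ℕ) : K := ∑ i ∈ Finset.range n, q ^ i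

/-- The `q`-factorial `[n]_q! = [1]_q ⋯ [n]_q`. -/
def qFact {K : Type*} [Field K] (q : K) (n : ℕ) : K := ∏ i ∈ Finset.range n, qInt q (i + 1)

/-- The `q`-binomial coefficient `[n]_q! / ([k]_q! [n - k]_q!)` for `k ≤ n`. -/
def qBinom {K : Type*} [Field K] (q : K) (n k : ℕ) : K :=
  qFact q n / (qFact q k * qFact q (n - k))

end

/-!
Work in the completion of `Dend`, the space of all functions on planar binary trees, and let `E` be
the sum of the right combs, so that `E = 1 + • ≺ E`. Right grafting by `y` is the difference of the
commuting operators `y ≻ ·` and `· ≺ y`, hence `(A ↶ exp y) ≺ exp y = exp y ≻ A`, where `exp y` is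
formed with the product `*`. For `y = φ(Ω)` the equation of `Ω` says that `exp y = 1 + • ≺ exp y`,
that is, `exp φ(Ω) = E`. Applying `· ≺ E` to the equation of `Ω_q` therefore turns it into
`E ≻ F[q] + • ≺ (F * E) = F * E + (q - 1) (E - 1)` for `F = φ(Ω_q)`, a linear equation that
determines `F` degree by degree.

Multiplication by `E` is transparent on trees: the coefficients of `F * E` and of `E ≻ F` at a tree
are sums over prefixes and suffixes of its word of leaf orientations, as soon as the coefficients of
`F` depend on this word only. For the coefficients in the theorem, which are `q`-beta numbers up to
a sign and a power of `q` counting inversions of the word, these sums telescope by the two Pascal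
rules for `q`-beta numbers.
-/

noncomputable section
/-! ### Power series in an operator that raises degrees -/

section PowerEval

open Finset (range sum_congr)
open PowerSeries (coeff coeff_mul)
open Finset.HasAntidiagonal (antidiagonal)

variable {ι κ R : Type*} [CommRing R] {deg : ι → ℕ} {deg' : κ → ℕ}

variable (R) in
/-- The families of scalars, indexed by a graded set `ι`, that vanish in degrees below `n`. -/
def vanishBelow (deg : ι → ℕ) (n : ℕ) : Submodule R (ι → R) where
  carrier := {f | ∀ i, deg i < n → f i = 0}
  zero_mem' _ _ := rfl
  add_mem' hf hg i hi := by rw [Pi.add_apply, hf i hi, hg i hi, add_zero]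
  smul_mem' c f hf i hi := by rw [Pi.smul_apply, hf i hi, smul_zero]

theorem mem_vanishBelow_zero (f : ι → R) : f ∈ vanishBelow R deg 0 :=
  fun _ hi => absurd hi (Nat.not_lt_zero _)

theorem eq_zero_of_vanishBelow_step {f : ι → R}
    (h : ∀ n, f ∈ vanishBelow R deg n → f ∈ vanishBelow R deg (n + 1)) : f = 0 := by
  have hmem (n : ℕ) : f ∈ vanishBelow R deg n := n.rec (mem_vanishBelow_zero f) h
  exact funext fun i => hmem (deg i + 1) i (Nat.lt_succ_self _)

/-- The endomorphisms that raise the filtration by degree; these can be substituted into an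
arbitrary power series. -/
def RaisesDegree (deg : ι → ℕ) (T : Module.End R (ι → R)) : Prop :=
  ∀ ⦃n f⦄, f ∈ vanishBelow R deg n → T f ∈ vanishBelow R deg (n + 1)

theorem RaisesDegree.sub {S T : Module.End R (ι → R)} (hS : RaisesDegree deg S)
    (hT : RaisesDegree deg T) : RaisesDegree deg (S - T) :=
  fun _ _ hf => sub_mem (hS hf) (hT hf)

theorem RaisesDegree.pow_mem {T : Module.End R (ι → R)} (hT : RaisesDegree deg T) {n : ℕ}
    {f : ι → R} (hf : f ∈ vanishBelow R deg n) (k : ℕ) :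
    (T ^ k) f ∈ vanishBelow R deg (n + k) := by
  induction k with
  | zero => exact hf
  | succ k ih => rw [pow_succ']; exact hT ih

/-- The operator `c(T) = ∑ₖ cₖ Tᵏ` for a power series `c` and a degree-raising `T`. In degree `n`
the sum stops at `k = n`, the terms beyond being zero. -/
def powerEval (deg : ι → ℕ) (c : PowerSeries R) (T : Module.End R (ι → R)) :
    Module.End R (ι → R) :=
  LinearMap.pi fun i => ∑ k ∈ range (deg i + 1), coeff k c • (LinearMap.proj i ∘ₗ T ^ k)

theorem powerEval_apply (c : PowerSeries R) (T : Module.End R (ι → R)) (f : ι → R) (i : ι) :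
    powerEval deg c T f i = ∑ k ∈ range (deg i + 1), coeff k c * (T ^ k) f i := by
  simp [powerEval]

theorem powerEval_apply_of_lt {T : Module.End R (ι → R)} (hT : RaisesDegree deg T)
    (c : PowerSeries R) (f : ι → R) {i : ι} {N : ℕ} (hi : deg i < N) :
    powerEval deg c T f i = ∑ k ∈ range N, coeff k c * (T ^ k) f i := by
  rw [powerEval_apply]
  refine Finset.sum_subset (Finset.range_mono hi) fun k _ hk => ?_
  have hk : deg i < 0 + k := by simpa using hk
  rw [hT.pow_mem (mem_vanishBelow_zero f) k i hk, mul_zero]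

theorem powerEval_sub_sum_mem {T : Module.End R (ι → R)} (hT : RaisesDegree deg T)
    (c : PowerSeries R) (f : ι → R) (N : ℕ) :
    powerEval deg c T f - ∑ k ∈ range N, coeff k c • (T ^ k) f ∈ vanishBelow R deg N := by
  intro i hi
  simp [powerEval_apply_of_lt hT c f hi]

theorem powerEval_powerEval_apply {S T : Module.End R (ι → R)} (hS : RaisesDegree deg S)
    (hT : RaisesDegree deg T) (c e : PowerSeries R) (f : ι → R) {i : ι} {N : ℕ} (hi : deg i < N) :
    powerEval deg c S (powerEval deg e T f) i =
      ∑ m ∈ range N, ∑ p ∈ antidiagonal m,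
        coeff p.1 c * coeff p.2 e * (S ^ p.1) ((T ^ p.2) f) i := by
  have truncate (k : ℕ) (hk : k < N) : (S ^ k) (powerEval deg e T f) i =
      ∑ l ∈ range (N - k), coeff l e * (S ^ k) ((T ^ l) f) i := by
    have h := hS.pow_mem (powerEval_sub_sum_mem hT e f (N - k)) k i (by omega)
    rw [map_sub, Pi.sub_apply, sub_eq_zero] at h
    simp [h]
  rw [powerEval_apply_of_lt hS c _ hi]
  simp only [Finset.Nat.sum_antidiagonal_eq_sum_range_succ fun k l =>
    coeff k c * coeff l e * (S ^ k) ((T ^ l) f) i]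
  rw [Finset.sum_range_diag_flip N fun k l => coeff k c * coeff l e * (S ^ k) ((T ^ l) f) i]
  refine sum_congr rfl fun k hk => ?_
  rw [truncate k (Finset.mem_range.mp hk), Finset.mul_sum]
  exact sum_congr rfl fun l _ => (mul_assoc _ _ _).symm

theorem powerEval_one (T : Module.End R (ι → R)) : powerEval deg 1 T = 1 := by
  ext f i
  simp [powerEval_apply, PowerSeries.coeff_one]

theorem powerEval_mul {T : Module.End R (ι → R)} (hT : RaisesDegree deg T)
    (c e : PowerSeries R) :
    powerEval deg (c * e) T = powerEval deg c T * powerEval deg e T := by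
  ext f i
  rw [Module.End.mul_apply, powerEval_powerEval_apply hT hT c e f (Nat.lt_succ_self _),
    powerEval_apply]
  refine sum_congr rfl fun m _ => ?_
  rw [coeff_mul, Finset.sum_mul]
  refine sum_congr rfl fun p hp => ?_
  rw [← Finset.HasAntidiagonal.mem_antidiagonal.mp hp, pow_add, Module.End.mul_apply]

theorem powerEval_exp_add [Algebra ℚ R] {S T : Module.End R (ι → R)} (hS : RaisesDegree deg S)
    (hT : RaisesDegree deg T) (hST : Commute S T) :
    powerEval deg (PowerSeries.exp R) (S + T) =
      powerEval deg (PowerSeries.exp R) S * powerEval deg (PowerSeries.exp R) T := by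
  ext f i
  rw [Module.End.mul_apply, powerEval_powerEval_apply hS hT _ _ f (Nat.lt_succ_self _),
    powerEval_apply]
  refine sum_congr rfl fun m _ => ?_
  rw [hST.add_pow', LinearMap.sum_apply, Finset.sum_apply, Finset.mul_sum]
  refine sum_congr rfl fun p hp => ?_
  obtain rfl := Finset.HasAntidiagonal.mem_antidiagonal.mp hp
  have hchoose : (1 / ((p.1 + p.2).factorial : ℚ)) * ((p.1 + p.2).choose p.1 : ℚ) =
      1 / (p.1.factorial : ℚ) * (1 / (p.2.factorial : ℚ)) := by
    rw [Nat.cast_add_choose]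
    field_simp
  simp only [PowerSeries.coeff_exp, ← map_mul, ← hchoose]
  simp [mul_assoc, Module.End.mul_apply]

theorem map_powerEval {S : Module.End R (ι → R)} {T : Module.End R (κ → R)}
    (hS : RaisesDegree deg S) {φ : (ι → R) →ₗ[R] (κ → R)}
    (hφ : ∀ n, ∀ f ∈ vanishBelow R deg n, φ f ∈ vanishBelow R deg' n) {f : ι → R} {g : κ → R}
    (hpow : ∀ k, φ ((S ^ k) f) = (T ^ k) g) (c : PowerSeries R) :
    φ (powerEval deg c S f) = powerEval deg' c T g := by
  ext i
  have h := hφ _ _ (powerEval_sub_sum_mem hS c f (deg' i + 1)) i (Nat.lt_succ_self _)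
  rw [map_sub, Pi.sub_apply, sub_eq_zero] at h
  rw [h, powerEval_apply]
  simp [hpow]

end PowerEval

/-! ### Series of planar binary trees -/

/-- The formal series `∑ f(u) u` of possibly empty planar binary trees, encoded by their families
of coefficients: the completion of `Dend` with a unit adjoined. -/
abbrev TreeSeries (R : Type*) : Type _ := BinaryTree Unit → R

namespace TreeSeries

open BinaryTree (nil node numNodes)

/-- The terms of the Loday–Ronco coproduct of `u`: the pairs of trees into which `u` is cut by the
path from one of its leaves to the root. They are also the pairs whose `*`-product contains `u`. -/
def splits : BinaryTree Unit → Multiset (BinaryTree Unit × BinaryTree Unit)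
  | nil => {(nil, nil)}
  | node _ l r =>
    (splits l).map (fun p => (p.1, node () p.2 r)) + (splits r).map (fun p => (node () l p.1, p.2))

theorem numNodes_add_of_mem_splits {u : BinaryTree Unit} {p : BinaryTree Unit × BinaryTree Unit}
    (hp : p ∈ splits u) : p.1.numNodes + p.2.numNodes = u.numNodes := by
  induction u generalizing p with
  | nil =>
    obtain rfl : p = (nil, nil) := by simpa [splits] using hp
    rfl
  | node x l r hl hr =>
    rcases Multiset.mem_add.mp hp with h | h <;>
      obtain ⟨p', hp', rfl⟩ := Multiset.mem_map.mp h
    · have := hl hp'; simp only [numNodes]; omega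
    · have := hr hp'; simp only [numNodes]; omega

variable {R : Type*} [CommRing R]

/-- The associative product `f * g` of tree series. -/
def conv : TreeSeries R →ₗ[R] TreeSeries R →ₗ[R] TreeSeries R :=
  LinearMap.mk₂ R (fun f g u => ((splits u).map fun p => f p.1 * g p.2).sum)
    (fun _ _ _ => funext fun _ => by simp [add_mul, Multiset.sum_map_add])
    (fun _ _ _ => funext fun _ => by simp [mul_assoc, Multiset.sum_map_mul_left])
    (fun _ _ _ => funext fun _ => by simp [mul_add, Multiset.sum_map_add])
    (fun _ _ _ => funext fun _ => by simp [mul_left_comm, Multiset.sum_map_mul_left])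

theorem conv_apply (f g : TreeSeries R) (u : BinaryTree Unit) :
    conv f g u = ((splits u).map fun p => f p.1 * g p.2).sum := rfl

theorem conv_nil (f g : TreeSeries R) : conv f g nil = f nil * g nil := by
  simp [conv_apply, splits]

theorem conv_node (f g : TreeSeries R) (x : Unit) (l r : BinaryTree Unit) :
    conv f g (node x l r) =
      conv f (g ∘ (node () · r)) l + conv (f ∘ node () l) g r := by
  simp [conv_apply, splits, Function.comp_def]

/-- The dendriform product `f ≻ g` of tree series, `one` being a unit only on the left. -/
def succ : TreeSeries R →ₗ[R] TreeSeries R →ₗ[R] TreeSeries R :=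
  LinearMap.mk₂ R (fun f g => fun
      | nil => 0
      | node _ l r => conv f (g ∘ (node () · r)) l)
    (fun _ _ _ => funext fun | nil => by simp | node _ _ _ => by simp)
    (fun _ _ _ => funext fun | nil => by simp | node _ _ _ => by simp)
    (fun _ _ _ => funext fun | nil => by simp | node _ _ _ => by simp [Pi.add_comp])
    (fun _ _ _ => funext fun | nil => by simp | node _ _ _ => by simp [Pi.smul_comp])

/-- The dendriform product `f ≺ g` of tree series, `one` being a unit only on the right. -/
def prec : TreeSeries R →ₗ[R] TreeSeries R →ₗ[R] TreeSeries R :=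
  LinearMap.mk₂ R (fun f g => fun
      | nil => 0
      | node _ l r => conv (f ∘ node () l) g r)
    (fun _ _ _ => funext fun | nil => by simp | node _ _ _ => by simp [Pi.add_comp])
    (fun _ _ _ => funext fun | nil => by simp | node _ _ _ => by simp [Pi.smul_comp])
    (fun _ _ _ => funext fun | nil => by simp | node _ _ _ => by simp)
    (fun _ _ _ => funext fun | nil => by simp | node _ _ _ => by simp)

theorem succ_nil (f g : TreeSeries R) : succ f g nil = 0 := rfl

theorem prec_nil (f g : TreeSeries R) : prec f g nil = 0 := rfl

theorem succ_node (f g : TreeSeries R) (x : Unit) (l r : BinaryTree Unit) :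
    succ f g (node x l r) = conv f (g ∘ (node () · r)) l := rfl

theorem prec_node (f g : TreeSeries R) (x : Unit) (l r : BinaryTree Unit) :
    prec f g (node x l r) = conv (f ∘ node () l) g r := rfl

theorem conv_eq_succ_add_prec {f g : TreeSeries R} (h : f nil * g nil = 0) :
    conv f g = succ f g + prec f g :=
  funext fun
    | nil => by simp [conv_nil, succ_nil, prec_nil, h]
    | node _ _ _ => conv_node f g _ _ _

theorem conv_conv_comm (f h : TreeSeries R) (G : BinaryTree Unit → BinaryTree Unit → R)
    (l r : BinaryTree Unit) :
    conv (fun a => conv f (G · a) l) h r = conv f (fun b => conv (G b) h r) l := by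
  simp only [conv_apply, ← Multiset.sum_map_mul_left, ← Multiset.sum_map_mul_right, mul_assoc]
  exact Multiset.sum_map_sum_map _ _

theorem conv_assoc (f g h : TreeSeries R) : conv (conv f g) h = conv f (conv g h) := by
  funext u
  induction u generalizing f g h with
  | nil => simp only [conv_nil, mul_assoc]
  | node x l r hl hr =>
    have hleft : conv f g ∘ node () l =
        (fun a => conv f (g ∘ (node () · a)) l) + conv (f ∘ node () l) g :=
      funext fun a => conv_node f g () l a
    have hright : conv g h ∘ (node () · r) =
        conv g (h ∘ (node () · r)) + fun b => conv (g ∘ node () b) h r :=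
      funext fun b => conv_node g h () b r
    rw [conv_node, conv_node, hleft, hright, map_add, map_add, LinearMap.add_apply, Pi.add_apply,
      Pi.add_apply, hl, hr, add_assoc]
    congr 2
    exact conv_conv_comm f h (fun b a => g (node () b a)) l r

theorem succ_conv (f g h : TreeSeries R) : succ (conv f g) h = succ f (succ g h) :=
  funext fun
    | nil => rfl
    | node _ l r => congrFun (conv_assoc f g (h ∘ (node () · r))) l

theorem prec_conv (f g h : TreeSeries R) : prec f (conv g h) = prec (prec f g) h :=
  funext fun
    | nil => rfl
    | node _ l r => (congrFun (conv_assoc (f ∘ node () l) g h) r).symm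

theorem succ_prec (f g h : TreeSeries R) : succ f (prec g h) = prec (succ f g) h :=
  funext fun
    | nil => rfl
    | node _ l r => (conv_conv_comm f h (fun b a => g (node () b a)) l r).symm

section Vanishing

variable {f g : TreeSeries R} {u : BinaryTree Unit}

theorem conv_eq_zero (h : ∀ a b, numNodes a + numNodes b = u.numNodes → f a = 0 ∨ g b = 0) :
    conv f g u = 0 := by
  refine Multiset.sum_eq_zero fun x hx => ?_
  obtain ⟨p, hp, rfl⟩ := Multiset.mem_map.mp hx
  exact (h _ _ (numNodes_add_of_mem_splits hp)).elim (mul_eq_zero_of_left · _)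
    (mul_eq_zero_of_right _ ·)

theorem succ_eq_zero (h : ∀ a b, numNodes a + numNodes b = u.numNodes → f a = 0 ∨ g b = 0) :
    succ f g u = 0 := by
  cases u with
  | nil => rfl
  | node x l r =>
    refine conv_eq_zero fun a b hab => h a (node () b r) ?_
    simp only [numNodes]
    omega

theorem prec_eq_zero (h : ∀ a b, numNodes a + numNodes b = u.numNodes → f a = 0 ∨ g b = 0) :
    prec f g u = 0 := by
  cases u with
  | nil => rfl
  | node x l r =>
    refine conv_eq_zero fun a b hab => h (node () l a) b ?_
    simp only [numNodes]
    omega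

end Vanishing

/-- The pre-Lie product `f ↦ f ↶ y = y ≻ f - f ≺ y` by a fixed series on the right. -/
def graftBy : TreeSeries R →ₗ[R] Module.End R (TreeSeries R) := succ - prec.flip

theorem graftBy_apply (y f : TreeSeries R) : graftBy y f = succ y f - prec f y := rfl

theorem graftBy_eq_zero {y f : TreeSeries R} {u : BinaryTree Unit}
    (h : ∀ a b, numNodes a + numNodes b = u.numNodes → f a = 0 ∨ y b = 0) :
    graftBy y f u = 0 := by
  rw [graftBy_apply, Pi.sub_apply, prec_eq_zero h,
    succ_eq_zero fun a b hab => (h b a (by omega)).symm, sub_zero]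

theorem graftBy_congr {y y' f f' : TreeSeries R} {u : BinaryTree Unit}
    (hy : ∀ a, a.numNodes ≤ u.numNodes → y a = y' a)
    (hf : ∀ a, a.numNodes ≤ u.numNodes → f a = f' a) : graftBy y f u = graftBy y' f' u := by
  have hsub : graftBy y f - graftBy y' f' = graftBy (y - y') f + graftBy y' (f - f') := by
    simp only [map_sub, LinearMap.sub_apply]
    abel
  rw [← sub_eq_zero, ← Pi.sub_apply, hsub, Pi.add_apply,
    graftBy_eq_zero (y := y - y') fun a b _ => .inr (sub_eq_zero.mpr (hy b (by omega))),
    graftBy_eq_zero (f := f - f') fun a b _ => .inl (sub_eq_zero.mpr (hf a (by omega))), add_zero]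

section RaisesDegree

variable {y : TreeSeries R}

theorem mem_vanishBelow_one_iff : y ∈ vanishBelow R numNodes 1 ↔ y nil = 0 :=
  ⟨fun h => h nil Nat.one_pos, fun h u hu => by
    cases u with
    | nil => exact h
    | node x l r => simp [numNodes] at hu⟩

theorem eq_zero_or_eq_zero_of_mem {m n : ℕ} {f g : TreeSeries R} (hf : f ∈ vanishBelow R numNodes m)
    (hg : g ∈ vanishBelow R numNodes n) {a b : BinaryTree Unit}
    (h : a.numNodes + b.numNodes < m + n) : f a = 0 ∨ g b = 0 :=
  (lt_or_lt_of_add_lt_add h).imp (hf a) (hg b)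

theorem conv_mem_vanishBelow {m n : ℕ} {f g : TreeSeries R} (hf : f ∈ vanishBelow R numNodes m)
    (hg : g ∈ vanishBelow R numNodes n) : conv f g ∈ vanishBelow R numNodes (m + n) :=
  fun _ hu => conv_eq_zero fun _ _ hab => eq_zero_or_eq_zero_of_mem hf hg (hab.trans_lt hu)

theorem succ_mem_vanishBelow {m n : ℕ} {f g : TreeSeries R} (hf : f ∈ vanishBelow R numNodes m)
    (hg : g ∈ vanishBelow R numNodes n) : succ f g ∈ vanishBelow R numNodes (m + n) :=
  fun _ hu => succ_eq_zero fun _ _ hab => eq_zero_or_eq_zero_of_mem hf hg (hab.trans_lt hu)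

theorem prec_mem_vanishBelow {m n : ℕ} {f g : TreeSeries R} (hf : f ∈ vanishBelow R numNodes m)
    (hg : g ∈ vanishBelow R numNodes n) : prec f g ∈ vanishBelow R numNodes (m + n) :=
  fun _ hu => prec_eq_zero fun _ _ hab => eq_zero_or_eq_zero_of_mem hf hg (hab.trans_lt hu)

theorem raisesDegree_conv (hy : y nil = 0) : RaisesDegree numNodes (conv y) :=
  fun n _ hf => add_comm 1 n ▸ conv_mem_vanishBelow (mem_vanishBelow_one_iff.mpr hy) hf

theorem raisesDegree_succ (hy : y nil = 0) : RaisesDegree numNodes (succ y) :=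
  fun n _ hf => add_comm 1 n ▸ succ_mem_vanishBelow (mem_vanishBelow_one_iff.mpr hy) hf

theorem raisesDegree_prec_flip (hy : y nil = 0) : RaisesDegree numNodes (prec.flip y) :=
  fun _ _ hf => prec_mem_vanishBelow hf (mem_vanishBelow_one_iff.mpr hy)

theorem raisesDegree_graftBy (hy : y nil = 0) : RaisesDegree numNodes (graftBy y) :=
  (raisesDegree_succ hy).sub (raisesDegree_prec_flip hy)

end RaisesDegree

/-- The empty tree, the unit of `*`. -/
def one : TreeSeries R := Pi.single nil 1

/-- The tree with one vertex. -/
def dot : TreeSeries R := Pi.single (node () nil nil) 1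

/-- The sum of the right combs, the trees all of whose left subtrees are empty. It will be the
exponential of the image of `Ω`. -/
def comb : TreeSeries R
  | nil => 1
  | node _ l r => one l * comb r

theorem single_node_comp_left (l r r' : BinaryTree Unit) (c : R) :
    (Pi.single (node () l r) c : TreeSeries R) ∘ (node () · r') =
      (Pi.single r 1 : TreeSeries R) r' • Pi.single l c := by
  ext a
  by_cases h : r' = r <;> by_cases h' : a = l <;> simp [h, h']

theorem single_node_comp_right (l l' r : BinaryTree Unit) (c : R) :
    (Pi.single (node () l r) c : TreeSeries R) ∘ node () l' =
      (Pi.single l 1 : TreeSeries R) l' • Pi.single r c := by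
  ext a
  by_cases h : l' = l <;> by_cases h' : a = r <;> simp [h, h']

theorem single_node_apply (l r p m : BinaryTree Unit) (x : Unit) :
    (Pi.single (node () l r) 1 : TreeSeries R) (node x p m) =
      (Pi.single l 1 : TreeSeries R) p * (Pi.single r 1 : TreeSeries R) m :=
  congrFun (single_node_comp_right l p r 1) m

theorem one_nil : (one : TreeSeries R) nil = 1 := Pi.single_eq_same _ _

theorem one_node (x : Unit) (l r : BinaryTree Unit) : (one : TreeSeries R) (node x l r) = 0 := rfl

theorem one_comp_node_left (r : BinaryTree Unit) : (one : TreeSeries R) ∘ (node () · r) = 0 := rfl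

theorem one_comp_node_right (l : BinaryTree Unit) : (one : TreeSeries R) ∘ node () l = 0 := rfl

theorem one_conv (g : TreeSeries R) : conv one g = g := by
  funext u
  induction u generalizing g with
  | nil => rw [conv_nil, one_nil, one_mul]
  | node x l r hl _ => simp [conv_node, hl, one_comp_node_right]

theorem conv_one (f : TreeSeries R) : conv f one = f := by
  funext u
  induction u generalizing f with
  | nil => rw [conv_nil, one_nil, mul_one]
  | node x l r _ hr => simp [conv_node, hr, one_comp_node_left]

theorem one_succ {g : TreeSeries R} (hg : g nil = 0) : succ one g = g :=
  funext fun
    | nil => hg.symm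
    | node _ l r => congrFun (one_conv (g ∘ (node () · r))) l

theorem prec_one {g : TreeSeries R} (hg : g nil = 0) : prec g one = g :=
  funext fun
    | nil => hg.symm
    | node _ l r => congrFun (conv_one (g ∘ node () l)) r

theorem succ_one (f : TreeSeries R) : succ f one = 0 :=
  funext fun
    | nil => rfl
    | node _ l r => by rw [succ_node, one_comp_node_left, map_zero]; rfl

theorem dot_prec_node (f : TreeSeries R) (x : Unit) (l r : BinaryTree Unit) :
    prec dot f (node x l r) = one l * f r := by
  rw [prec_node, dot, single_node_comp_right]
  change conv (one l • one) f r = _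
  rw [map_smul, LinearMap.smul_apply, Pi.smul_apply, one_conv, smul_eq_mul]

theorem comb_eq_one_add_dot_prec_comb : (comb : TreeSeries R) = one + prec dot comb :=
  funext fun
    | nil => by simp [comb, one_nil, prec_nil]
    | node _ l r => by simp [comb, one_node, dot_prec_node]

theorem eq_comb {f : TreeSeries R} (hf : f = one + prec dot f) : f = comb := by
  funext u
  induction u with
  | nil => rw [hf]; simp [comb, one_nil, prec_nil]
  | node x l r _ hr => rw [hf]; simp [comb, one_node, dot_prec_node, hr]

section Exponential

variable (y : TreeSeries R)

theorem commute_succ_prec_flip (z : TreeSeries R) : Commute (succ y) (prec.flip z) :=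
  LinearMap.ext fun f => succ_prec y f z

theorem commute_prec_flip_graftBy : Commute (prec.flip y) (graftBy y) :=
  (commute_succ_prec_flip y y).symm.sub_right (Commute.refl _)

theorem prec_flip_add_graftBy : prec.flip y + graftBy y = succ y :=
  add_sub_cancel _ _

theorem conv_pow_succ_one (m : ℕ) :
    (conv y ^ (m + 1)) one = conv ((conv y ^ m) one) y := by
  induction m with
  | zero => simp [one_conv, conv_one]
  | succ m ih =>
    rw [pow_succ' _ (m + 1), Module.End.mul_apply]
    conv_lhs => rw [ih, ← conv_assoc]
    rw [pow_succ', Module.End.mul_apply]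

theorem succ_conv_pow_one (m : ℕ) {f : TreeSeries R} (hf : f nil = 0) :
    succ ((conv y ^ m) one) f = (succ y ^ m) f := by
  induction m with
  | zero => exact one_succ hf
  | succ m ih => rw [pow_succ', pow_succ', Module.End.mul_apply, succ_conv, ih]; rfl

theorem prec_conv_pow_one (m : ℕ) {f : TreeSeries R} (hf : f nil = 0) :
    prec f ((conv y ^ m) one) = (prec.flip y ^ m) f := by
  induction m with
  | zero => exact prec_one hf
  | succ m ih => rw [conv_pow_succ_one, prec_conv, ih, pow_succ']; rfl

variable {y}

theorem conv_pow_succ_one_eq_sum (hy : y nil = 0) (m : ℕ) :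
    (conv y ^ (m + 1)) one = ∑ p ∈ Finset.HasAntidiagonal.antidiagonal m,
      (m + 1).choose p.1 • (prec.flip y ^ p.1) ((graftBy y ^ p.2) y) := by
  induction m with
  | zero => simp [conv_one]
  | succ m ih =>
    rw [conv_pow_succ_one, conv_eq_succ_add_prec (by rw [hy, mul_zero]), succ_conv_pow_one y _ hy,
      ← prec_flip_add_graftBy, (commute_prec_flip_graftBy y).add_pow', ih, LinearMap.sum_apply,
      Finset.Nat.sum_antidiagonal_succ, Finset.Nat.sum_antidiagonal_succ, add_assoc, map_sum,
      LinearMap.sum_apply]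
    congr 1
    rw [← Finset.sum_add_distrib]
    refine Finset.sum_congr rfl fun p _ => ?_
    rw [Nat.choose_succ_succ (m + 1) p.1, add_smul, add_comm, map_nsmul, LinearMap.smul_apply,
      pow_succ']
    rfl

end Exponential

section

variable [Algebra ℚ R]

/-- The exponential `∑ y ^ m / m!` for the product `*` of a series `y` without constant term. -/
def treeExp (y : TreeSeries R) : TreeSeries R :=
  powerEval numNodes (PowerSeries.exp R) (conv y) one

variable (R) in
/-- The power series `(exp x - 1) / x`. -/
def expDiv : PowerSeries R :=
  PowerSeries.mk fun k => algebraMap ℚ R (1 / (k + 1).factorial)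

theorem expDiv_mul_X : expDiv R * PowerSeries.X = PowerSeries.exp R - 1 := by
  ext n
  cases n with
  | zero => simp
  | succ n => simp [expDiv, PowerSeries.coeff_succ_mul_X, PowerSeries.coeff_exp,
      PowerSeries.coeff_one]

theorem expDiv_mul_bernoulliPowerSeries : expDiv R * bernoulliPowerSeries R = 1 := by
  have h : expDiv R * bernoulliPowerSeries R * PowerSeries.X = 1 * PowerSeries.X := by
    rw [mul_right_comm, expDiv_mul_X, mul_comm, bernoulliPowerSeries_mul_exp_sub_one, one_mul]
  ext n
  have hn := congrArg (PowerSeries.coeff (n + 1)) h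
  rwa [PowerSeries.coeff_succ_mul_X, PowerSeries.coeff_succ_mul_X] at hn

variable {y f g : TreeSeries R}

theorem succ_treeExp (hy : y nil = 0) (hf : f nil = 0) :
    succ (treeExp y) f = powerEval numNodes (PowerSeries.exp R) (succ y) f :=
  map_powerEval (φ := succ.flip f) (raisesDegree_conv hy)
    (fun n _ h => by simpa using succ_mem_vanishBelow h (mem_vanishBelow_zero f))
    (fun k => succ_conv_pow_one y k hf) _

theorem prec_treeExp (hy : y nil = 0) (hf : f nil = 0) :
    prec f (treeExp y) = powerEval numNodes (PowerSeries.exp R) (prec.flip y) f :=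
  map_powerEval (φ := prec f) (raisesDegree_conv hy)
    (fun n _ h => by simpa using prec_mem_vanishBelow (mem_vanishBelow_zero f) h)
    (fun k => prec_conv_pow_one y k hf) _

/-- The operators `y ≻ ·` and `· ≺ y` commute, and `· ↶ y` is their difference. -/
theorem exp_graftBy_prec_treeExp (hy : y nil = 0) (hf : f nil = 0) :
    prec (powerEval numNodes (PowerSeries.exp R) (graftBy y) f) (treeExp y) =
      succ (treeExp y) f := by
  have hg : powerEval numNodes (PowerSeries.exp R) (graftBy y) f nil = 0 := by
    simp [powerEval_apply, hf, numNodes]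
  rw [prec_treeExp hy hg, succ_treeExp hy hf, ← prec_flip_add_graftBy,
    powerEval_exp_add (raisesDegree_prec_flip hy) (raisesDegree_graftBy hy)
      (commute_prec_flip_graftBy y), Module.End.mul_apply]

theorem treeExp_eq_one_add_prec (hy : y nil = 0) :
    treeExp y = one + prec (powerEval numNodes (expDiv R) (graftBy y) y) (treeExp y) := by
  have hnil : powerEval numNodes (expDiv R) (graftBy y) y nil = 0 := by
    simp [powerEval_apply, hy, numNodes]
  rw [prec_treeExp hy hnil, treeExp]
  ext u
  rw [powerEval_apply_of_lt (N := numNodes u + 2) (raisesDegree_conv hy) _ _ (by omega),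
    Finset.sum_range_succ', Pi.add_apply, powerEval_powerEval_apply (N := numNodes u + 1)
      (raisesDegree_prec_flip hy) (raisesDegree_graftBy hy) _ _ _ (by omega), add_comm]
  congr 1
  · simp
  refine Finset.sum_congr rfl fun m _ => ?_
  rw [conv_pow_succ_one_eq_sum hy, Finset.sum_apply, Finset.mul_sum]
  refine Finset.sum_congr rfl fun p hp => ?_
  have hm : m + 1 = p.1 + (p.2 + 1) := by rw [← Finset.HasAntidiagonal.mem_antidiagonal.mp hp]; ring
  have hchoose : (1 / ((m + 1).factorial : ℚ)) * ((m + 1).choose p.1 : ℚ) =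
      1 / (p.1.factorial : ℚ) * (1 / ((p.2 + 1).factorial : ℚ)) := by
    rw [hm, Nat.cast_add_choose]
    field_simp
  rw [PowerSeries.coeff_exp, PowerSeries.coeff_exp, expDiv, PowerSeries.coeff_mk, ← map_mul,
    ← hchoose]
  simp [mul_assoc]

theorem treeExp_eq_comb (hy : y nil = 0)
    (h : powerEval numNodes (bernoulliPowerSeries R) (graftBy y) dot = y) :
    treeExp y = comb := by
  refine eq_comb ?_
  have hdot : powerEval numNodes (expDiv R) (graftBy y) y = dot := by
    have hmul := powerEval_mul (raisesDegree_graftBy hy) (expDiv R) (bernoulliPowerSeries R)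
    rw [expDiv_mul_bernoulliPowerSeries, powerEval_one] at hmul
    simpa only [Module.End.mul_apply, Module.End.one_apply, h] using
      (LinearMap.congr_fun hmul dot).symm
  conv_lhs => rw [treeExp_eq_one_add_prec hy, hdot]

theorem exp_graftBy_prec_comb (hy : y nil = 0)
    (h : powerEval numNodes (bernoulliPowerSeries R) (graftBy y) dot = y) (hf : f nil = 0) :
    prec (powerEval numNodes (PowerSeries.exp R) (graftBy y) f) comb = succ comb f := by
  rw [← treeExp_eq_comb hy h, exp_graftBy_prec_treeExp hy hf]

end

/-- The operator `A ↦ A[q]`, which multiplies the trees of degree `n` by `q ^ n`. -/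
def shift (q : R) : TreeSeries R →ₗ[R] TreeSeries R where
  toFun f u := q ^ u.numNodes * f u
  map_add' _ _ := funext fun _ => mul_add _ _ _
  map_smul' _ _ := funext fun _ => mul_left_comm _ _ _

theorem shift_apply (q : R) (f : TreeSeries R) (u : BinaryTree Unit) :
    shift q f u = q ^ u.numNodes * f u := rfl

theorem shift_mem_vanishBelow (q : R) {n : ℕ} {f : TreeSeries R}
    (hf : f ∈ vanishBelow R numNodes n) :
    shift q f ∈ vanishBelow R numNodes n :=
  fun u hu => by rw [shift_apply, hf u hu, mul_zero]

theorem comb_sub_one_mem_vanishBelow :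
    (comb - one : TreeSeries R) ∈ vanishBelow R numNodes 1 :=
  mem_vanishBelow_one_iff.mpr (by rw [Pi.sub_apply, one_nil, comb, sub_self])

theorem comb_node (x : Unit) (l r : BinaryTree Unit) :
    (comb : TreeSeries R) (node x l r) = (one : TreeSeries R) l * (comb : TreeSeries R) r := rfl

/-- Modulo a degree on which `f` vanishes, the equation reads `q ^ n • f = f`. -/
theorem eq_zero_of_succ_comb_shift_add {K : Type*} [Field K] {q : K} (hq : ∀ n, q ^ (n + 1) ≠ 1)
    {f : TreeSeries K} (hf : f nil = 0)
    (h : succ comb (shift q f) + prec dot (conv f comb) = conv f comb) : f = 0 := by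
  refine eq_zero_of_vanishBelow_step (deg := numNodes) fun n ih => ?_
  have hsucc := succ_mem_vanishBelow comb_sub_one_mem_vanishBelow (shift_mem_vanishBelow q ih)
  have hconv := conv_mem_vanishBelow ih (comb_sub_one_mem_vanishBelow (R := K))
  have hdot : dot ∈ vanishBelow K numNodes 1 := mem_vanishBelow_one_iff.mpr rfl
  have hprec := prec_mem_vanishBelow hdot
    (conv_mem_vanishBelow ih (mem_vanishBelow_zero (comb : TreeSeries K)))
  rw [map_sub, LinearMap.sub_apply, one_succ (by rw [shift_apply, hf, mul_zero])] at hsucc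
  rw [map_sub, conv_one] at hconv
  rintro (_ | ⟨x, l, r⟩) hu
  · exact hf
  have hs := hsucc _ (hu.trans_eq (add_comm n 1))
  have hc := hconv _ hu
  have hp := hprec _ (hu.trans_eq (by ring))
  have hu' := congrFun h (node x l r)
  simp only [Pi.add_apply, Pi.sub_apply, shift_apply] at hs hc hu'
  have hmul : (q ^ (node x l r).numNodes - 1) * f (node x l r) = 0 := by
    linear_combination hu' - hs + hc - hp
  exact (mul_eq_zero.mp hmul).resolve_left (sub_ne_zero.mpr (hq _))

end TreeSeries

/-! ### Sums over leaf words -/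

section QAnalogues

variable {K : Type*} [Field K]

theorem qInt_add (q : K) (m n : ℕ) : qInt q (m + n) = qInt q m + q ^ m * qInt q n := by
  simp only [qInt, Finset.sum_range_add, pow_add, Finset.mul_sum]

theorem qInt_mul_sub_one (q : K) (n : ℕ) : qInt q n * (q - 1) = q ^ n - 1 :=
  geom_sum_mul q n

theorem qInt_ne_zero {q : K} (hq : ∀ n, q ^ (n + 1) ≠ 1) (n : ℕ) : qInt q (n + 1) ≠ 0 := by
  intro h
  have hsub := qInt_mul_sub_one q (n + 1)
  rw [h, zero_mul] at hsub
  exact hq n (sub_eq_zero.mp hsub.symm)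

theorem qFact_succ (q : K) (n : ℕ) : qFact q (n + 1) = qFact q n * qInt q (n + 1) :=
  Finset.prod_range_succ _ _

theorem qFact_ne_zero {q : K} (hq : ∀ n, qInt q (n + 1) ≠ 0) (n : ℕ) : qFact q n ≠ 0 :=
  Finset.prod_ne_zero_iff.mpr fun i _ => hq i

/-- The `q`-beta number `[m]! [n]! / [m + n + 1]!`, a value of the `q`-beta function. -/
def qBeta (q : K) (m n : ℕ) : K := qFact q m * qFact q n / qFact q (m + n + 1)

theorem inv_qInt_mul_qBinom_inv (q : K) (m n : ℕ) :
    (qInt q (m + n + 1))⁻¹ * (qBinom q (m + n) m)⁻¹ = qBeta q m n := by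
  rw [qBinom, Nat.add_sub_cancel_left, qBeta, qFact_succ q (m + n), inv_div, ← div_eq_inv_mul,
    div_div]

variable {q : K} (hq : ∀ n, qInt q (n + 1) ≠ 0)

include hq

theorem qBeta_zero_right (n : ℕ) : qBeta q n 0 * qInt q (n + 1) = 1 := by
  have hint := hq n
  have hfact := qFact_ne_zero hq n
  rw [qBeta, add_zero, qFact_succ, show qFact q 0 = 1 from Finset.prod_range_zero _]
  field_simp

theorem qBeta_succ_left (m n : ℕ) :
    qBeta q (m + 1) n = qBeta q m n * qInt q (m + 1) / qInt q (m + n + 2) := by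
  have hint := hq (m + n + 1)
  have hfact := qFact_ne_zero hq (m + n + 1)
  rw [qBeta, qBeta, show m + 1 + n + 1 = m + n + 1 + 1 by ring, qFact_succ q m,
    qFact_succ q (m + n + 1)]
  field_simp

theorem qBeta_succ_right (m n : ℕ) :
    qBeta q m (n + 1) = qBeta q m n * qInt q (n + 1) / qInt q (m + n + 2) := by
  have hint := hq (m + n + 1)
  have hfact := qFact_ne_zero hq (m + n + 1)
  rw [qBeta, qBeta, ← add_assoc m n 1, qFact_succ q n, qFact_succ q (m + n + 1)]
  field_simp

theorem pow_mul_qBeta_succ_left_add (m n : ℕ) :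
    q ^ (n + 1) * qBeta q (m + 1) n + qBeta q m (n + 1) = qBeta q m n := by
  have hint : qInt q (m + n + 2) ≠ 0 := hq _
  have hadd : qInt q (m + n + 2) = qInt q (n + 1) + q ^ (n + 1) * qInt q (m + 1) := by
    rw [← qInt_add]
    ring_nf
  rw [qBeta_succ_left hq, qBeta_succ_right hq]
  field_simp
  rw [hadd]
  ring

theorem qBeta_succ_left_add_pow_mul (m n : ℕ) :
    qBeta q (m + 1) n + q ^ (m + 1) * qBeta q m (n + 1) = qBeta q m n := by
  have hint : qInt q (m + n + 2) ≠ 0 := hq _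
  have hadd : qInt q (m + n + 2) = qInt q (m + 1) + q ^ (m + 1) * qInt q (n + 1) := by
    rw [← qInt_add]
    ring_nf
  rw [qBeta_succ_left hq, qBeta_succ_right hq]
  field_simp
  rw [hadd]

end QAnalogues

namespace LeafWord

open BinaryTree (nil node numNodes)
open PBT (leafSides)
open TreeSeries

/-- The orientations of all leaves of a tree but the last one. -/
def word : BinaryTree Unit → List Bool
  | nil => []
  | node _ l r => leafSides l true ++ word r

theorem leafSides_false (u : BinaryTree Unit) : leafSides u false = word u ++ [false] := by
  induction u with
  | nil => rfl
  | node x l r _ hr => rw [leafSides, word, hr, List.append_assoc]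

theorem leafSides_node (x : Unit) (l r : BinaryTree Unit) (b : Bool) :
    leafSides (node x l r) b = word (node x l r) ++ [false] :=
  leafSides_false (node x l r)

theorem exists_leafSides_true (u : BinaryTree Unit) : ∃ w, leafSides u true = true :: w := by
  induction u with
  | nil => exact ⟨[], rfl⟩
  | node x l r hl _ =>
    obtain ⟨w, hw⟩ := hl
    exact ⟨w ++ leafSides r false, by rw [leafSides, hw, List.cons_append]⟩

theorem exists_word_node (x : Unit) (l r : BinaryTree Unit) :
    ∃ w, word (node x l r) = true :: w := by
  obtain ⟨w, hw⟩ := exists_leafSides_true l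
  exact ⟨w ++ word r, by rw [word, hw, List.cons_append]⟩

theorem word_eq_nil_or_true_cons (u : BinaryTree Unit) : word u = [] ∨ ∃ w, word u = true :: w :=
  match u with
  | nil => .inl rfl
  | node x l r => .inr (exists_word_node x l r)

theorem length_leafSides (u : BinaryTree Unit) (b : Bool) :
    (leafSides u b).length = numNodes u + 1 := by
  induction u generalizing b with
  | nil => rfl
  | node x l r hl hr =>
    rw [leafSides, List.length_append, hl, hr, numNodes]
    omega

theorem length_word (u : BinaryTree Unit) : (word u).length = numNodes u := by
  have h := length_leafSides u false
  rw [leafSides_false, List.length_append, List.length_singleton] at h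
  omega

/-- The number of pairs consisting of a letter `false` and a later letter `true`. -/
def inv : List Bool → ℕ
  | [] => 0
  | true :: w => inv w
  | false :: w => inv w + w.count true

theorem inv_append_true (w : List Bool) : inv (w ++ [true]) = inv w + w.count false := by
  induction w with
  | nil => rfl
  | cons x w ih => cases x <;> simp [inv, ih]; omega

theorem inv_append_false (w : List Bool) : inv (w ++ [false]) = inv w := by
  induction w with
  | nil => rfl
  | cons x w ih => cases x <;> simp [inv, ih]

theorem inv_replicate_true (n : ℕ) : inv (List.replicate n true) = 0 := by
  induction n with
  | zero => rfl
  | succ _ ih => exact ih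

theorem eq_replicate_true {w : List Bool} (hw : false ∉ w) : w = List.replicate w.length true :=
  List.eq_replicate_iff.mpr ⟨rfl, fun b hb => by cases b <;> simp_all⟩

section Sums

variable {R : Type*} [CommRing R]

/-- The sum of `F v` over the factorizations of a word as `v` or as `v ++ x :: z`, where `z` has no
letter `false`: the form taken by right multiplication by `comb` on leaf words. -/
def prefixSum (F : List Bool → R) : List Bool → R
  | [] => F []
  | x :: w => F [] * (if false ∈ w then 0 else 1) + prefixSum (F ∘ List.cons x) w

theorem prefixSum_append_true (F : List Bool → R) (w : List Bool) :
    prefixSum F (w ++ [true]) = prefixSum F w + F (w ++ [true]) := by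
  induction w generalizing F with
  | nil => simp [prefixSum]
  | cons x w ih => simp [prefixSum, ih, add_assoc]

theorem prefixSum_append_false_cons (F : List Bool → R) (w z : List Bool) :
    prefixSum F (w ++ false :: z) =
      F w * (if false ∈ z then 0 else 1) + prefixSum (fun v => F (w ++ false :: v)) z := by
  induction w generalizing F with
  | nil => rfl
  | cons x w ih => simp [prefixSum, ih]

theorem prefixSum_append_false (F : List Bool → R) (w : List Bool) :
    prefixSum F (w ++ [false]) = F w + F (w ++ [false]) := by
  simp [prefixSum_append_false_cons, prefixSum]

theorem prefixSum_leafSides_append (F : List Bool → R) (l : BinaryTree Unit) (z : List Bool) :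
    prefixSum F (leafSides l true ++ z) =
      F (word l) * (if false ∈ z then 0 else 1) + prefixSum (F ∘ (leafSides l true ++ ·)) z := by
  cases l with
  | nil => rfl
  | node x a b =>
    simp [leafSides_node, prefixSum_append_false_cons, Function.comp_def]

theorem comb_apply (u : BinaryTree Unit) :
    (comb : TreeSeries R) u = if false ∈ word u then 0 else 1 := by
  induction u with
  | nil => rfl
  | node x l r _ hr =>
    rw [comb, hr]
    cases l with
    | nil => simp [one_nil, word, leafSides]
    | node y a b => simp [one_node, word, leafSides_node]

theorem comb_comp_node_left (r : BinaryTree Unit) :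
    (comb : TreeSeries R) ∘ (node () · r) = (comb : TreeSeries R) r • one :=
  funext fun l => mul_comm (one l : R) (comb r)

theorem comb_comp_node_right (l : BinaryTree Unit) :
    (comb : TreeSeries R) ∘ node () l = (one : TreeSeries R) l • comb := rfl

theorem conv_comb (F : List Bool → R) (u : BinaryTree Unit) :
    conv (F ∘ word) comb u = prefixSum F (word u) := by
  induction u generalizing F with
  | nil => simp [conv_nil, word, comb, prefixSum]
  | node x l r _ hr =>
    rw [conv_node, comb_comp_node_left, map_smul, conv_one, word, prefixSum_leafSides_append,
      ← comb_apply, ← hr, mul_comm]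
    rfl

/-- The sum of the values of `H` at the suffixes of a word with their first letter changed to
`true`, up to the first letter `false`: the form taken by left multiplication by `comb` on leaf
words. -/
def suffixSum (H : List Bool → R) : List Bool → R
  | [] => 0
  | true :: w => H (true :: w) + suffixSum H w
  | false :: w => H (true :: w)

theorem suffixSum_append (H : List Bool → R) {v : List Bool} (hv : false ∈ v) (z : List Bool) :
    suffixSum H (v ++ z) = suffixSum (fun w => H (w ++ z)) v := by
  induction v with
  | nil => simp at hv
  | cons x v ih =>
    cases x with
    | true => simp [suffixSum, ih (by simpa using hv)]
    | false => rfl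

theorem suffixSum_leafSides_false (H : List Bool → R) (u : BinaryTree Unit) :
    suffixSum H (leafSides u false) = suffixSum H (leafSides u true) := by
  cases u with
  | nil => simp [leafSides, suffixSum]
  | node x l r => rfl

theorem comb_conv (H : List Bool → R) (u : BinaryTree Unit) :
    conv comb (fun b => H (leafSides b true)) u = suffixSum H (leafSides u true) := by
  induction u generalizing H with
  | nil => simp [conv_nil, comb, leafSides, suffixSum]
  | node x l r hl hr =>
    rw [conv_node, comb_comp_node_right, map_smul, LinearMap.smul_apply, Pi.smul_apply, hr,
      leafSides]
    refine (congrArg (· + _) (hl fun w => H (w ++ leafSides r false))).trans ?_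
    cases l with
    | nil => simp [leafSides, suffixSum, one_nil, suffixSum_leafSides_false]
    | node y a b =>
      rw [suffixSum_append H (by simp [leafSides_node]), one_node, zero_smul, add_zero]

end Sums

section Weight

variable {K : Type*} [Field K]

/-- The coefficient of a tree in `φ(Ω_q)`, as a function of the word of its inner leaves. -/
def weight (q : K) (w : List Bool) : K :=
  (-1) ^ w.count false * q ^ inv w * qBeta q (w.count true) (w.count false)

/-- The coefficient of a tree in `φ(Ω_q)`, as a function of the word of all its leaves but the
last one. The empty tree, whose word is empty, has coefficient `0`. -/
def fullWeight (q : K) : List Bool → K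
  | [] => 0
  | _ :: w => weight q w

theorem prefixSum_fullWeight_cons (q : K) (x : Bool) (w : List Bool) :
    prefixSum (fullWeight q) (x :: w) = prefixSum (weight q) w := by
  rw [prefixSum, fullWeight, zero_mul, zero_add]
  rfl

variable {q : K} (hq : ∀ n, qInt q (n + 1) ≠ 0)

include hq

theorem prefixSum_weight {w : List Bool} {g : ℕ} (hg : w.count false = g + 1) :
    prefixSum (weight q) w =
      (-1) ^ g * q ^ (inv w + g + 1) * qBeta q (w.count true + 1) g := by
  induction w using List.reverseRecOn generalizing g with
  | nil => simp at hg
  | append_singleton w x ih =>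
    cases x with
    | true =>
      have hg' : w.count false = g + 1 := by simpa using hg
      rw [prefixSum_append_true, ih hg', weight, inv_append_true]
      simp only [List.count_append, List.count_singleton_self, hg', List.count_singleton,
        Bool.true_beq, Bool.false_eq_true, if_false, add_zero]
      linear_combination (-(-1) ^ g * q ^ (inv w + g + 1)) *
        pow_mul_qBeta_succ_left_add hq (w.count true + 1) g
    | false =>
      have hg' : w.count false = g := by simpa using hg
      rw [prefixSum_append_false, weight, weight, inv_append_false]
      simp only [List.count_append, List.count_singleton_self, hg', List.count_singleton,
        Bool.false_beq, Bool.not_true, Bool.false_eq_true, if_false, add_zero]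
      linear_combination (-(-1) ^ g * q ^ inv w) *
        pow_mul_qBeta_succ_left_add hq (w.count true) g

theorem weight_replicate_true_mul_qInt (n : ℕ) :
    weight q (List.replicate n true) * qInt q (n + 1) = 1 := by
  simpa [weight, inv_replicate_true, List.count_replicate] using qBeta_zero_right hq n

theorem weight_true_cons (w : List Bool) :
    q ^ (w.length + 2) * weight q (true :: w) + prefixSum (weight q) w =
      prefixSum (weight q) (true :: w) + (q - 1) * (if false ∈ w then 0 else 1) := by
  by_cases hw : false ∈ w
  · obtain ⟨g, hg⟩ := Nat.exists_eq_add_one.mpr (List.count_pos_iff.mpr hw)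
    rw [prefixSum_weight hq hg, prefixSum_weight hq (w := true :: w) (by simpa using hg), weight,
      if_pos hw, ← List.count_true_add_count_false w]
    simp only [List.count_cons_self, hg, List.count_cons, inv, Bool.true_beq, Bool.false_eq_true,
      if_false, add_zero]
    linear_combination (-(-1) ^ g * q ^ (inv w + g + 1)) *
      qBeta_succ_left_add_pow_mul hq (w.count true + 1) g
  · obtain ⟨n, rfl⟩ : ∃ n, w = List.replicate n true := ⟨_, eq_replicate_true hw⟩
    rw [if_neg hw, List.length_replicate, ← List.replicate_succ, List.replicate_succ',
      prefixSum_append_true, ← List.replicate_succ']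
    have hweight := weight_replicate_true_mul_qInt hq (n + 1)
    have hint := qInt_mul_sub_one q (n + 2)
    linear_combination (q - 1) * hweight - weight q (List.replicate (n + 1) true) * hint

theorem weight_false_cons (w : List Bool) :
    q ^ (w.length + 2) * weight q (false :: w) + q ^ (w.length + 1) * weight q w =
      prefixSum (weight q) (false :: w) := by
  rw [prefixSum_weight hq (w := false :: w) List.count_cons_self, weight, weight,
    ← List.count_true_add_count_false w]
  simp only [List.count_cons_self, List.count_cons, inv, Bool.false_beq, Bool.not_true,
    Bool.false_eq_true, if_false, add_zero]
  linear_combination (-(-1) ^ w.count false *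
    q ^ (inv w + w.count true + w.count false + 1)) *
      qBeta_succ_left_add_pow_mul hq (w.count true) (w.count false)

theorem suffixSum_eq_prefixSum {w : List Bool} (hw : false ∈ w) :
    suffixSum (fun v => q ^ v.length * fullWeight q v) (true :: w) =
      prefixSum (weight q) w := by
  induction w with
  | nil => simp at hw
  | cons x w ih =>
    rw [suffixSum]
    cases x with
    | true =>
      have hw' : false ∈ w := by simpa using hw
      have h := weight_true_cons hq w
      rw [if_pos hw', mul_zero, add_zero] at h
      rw [ih hw', ← h]
      rfl
    | false => exact weight_false_cons hq w

end Weight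

variable {K : Type*} [Field K]

/-- The image of `Ω_q` under `φ`, as a tree series. -/
def series (q : K) : TreeSeries K := fullWeight q ∘ word

theorem shift_series_comp_node (q : K) (r : BinaryTree Unit) :
    shift q (series q) ∘ (node () · r) = fun l =>
      q ^ (leafSides l true ++ word r).length * fullWeight q (leafSides l true ++ word r) := by
  funext l
  rw [Function.comp_apply, shift_apply, ← length_word]
  rfl

section Equation

variable {q : K} (hq : ∀ n, qInt q (n + 1) ≠ 0)

include hq

theorem series_equation_apply_node_nil (x : Unit) (r : BinaryTree Unit) :
    succ comb (shift q (series q)) (node x nil r) + conv (series q) comb r =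
      conv (series q) comb (node x nil r) + (q - 1) * (comb : TreeSeries K) (node x nil r) := by
  have hsucc : succ comb (shift q (series q)) (node x nil r) =
      q ^ ((word r).length + 1) * weight q (word r) := by
    rw [succ_node, conv_nil, shift_series_comp_node, comb, one_mul]
    rfl
  have hnode : conv (series q) comb (node x nil r) = prefixSum (weight q) (word r) := by
    rw [series, conv_comb]
    exact prefixSum_fullWeight_cons q true (word r)
  rw [hsucc, hnode, comb_node, one_nil, one_mul, comb_apply, series, conv_comb]
  rcases word_eq_nil_or_true_cons r with hr | ⟨w, hr⟩
  · have hone := weight_replicate_true_mul_qInt hq 0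
    simp only [List.replicate_zero, qInt, Finset.sum_range_one, zero_add, pow_zero,
      mul_one] at hone
    simp [hr, prefixSum, fullWeight, hone]
  · rw [hr, prefixSum_fullWeight_cons]
    simpa using weight_true_cons hq w

theorem series_equation_apply_node_node (x : Unit) (l₁ l₂ r : BinaryTree Unit) :
    succ comb (shift q (series q)) (node x (node () l₁ l₂) r) =
      conv (series q) comb (node x (node () l₁ l₂) r) := by
  obtain ⟨w, hw⟩ := exists_word_node x (node () l₁ l₂) r
  have hfalse : false ∈ w := by
    have : false ∈ true :: w := by rw [← hw, word, leafSides_node]; simp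
    simpa using this
  rw [succ_node, shift_series_comp_node,
    comb_conv fun v => q ^ (v ++ word r).length * fullWeight q (v ++ word r),
    ← suffixSum_append (fun v => q ^ v.length * fullWeight q v) (by simp [leafSides_node])]
  rw [← word, hw, suffixSum_eq_prefixSum hq hfalse, series, conv_comb, hw,
    prefixSum_fullWeight_cons]

theorem series_equation :
    succ comb (shift q (series q)) + prec dot (conv (series q) comb) =
      conv (series q) comb + (q - 1) • (comb - one) := by
  funext u
  simp only [Pi.add_apply, Pi.smul_apply, Pi.sub_apply, smul_eq_mul]
  rcases u with _ | ⟨x, _ | ⟨y, l₁, l₂⟩, r⟩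
  · simp [succ_nil, prec_nil, conv_nil, series, word, fullWeight, comb, one_nil]
  · rw [dot_prec_node, one_nil, one_mul, one_node, sub_zero]
    exact series_equation_apply_node_nil hq x r
  · rw [dot_prec_node, series_equation_apply_node_node hq, comb_node]
    simp only [one_node]
    ring

end Equation

theorem eq_series {q : K} (hq : ∀ n, q ^ (n + 1) ≠ 1) {f : TreeSeries K} (hf : f nil = 0)
    (h : succ comb (shift q f) + prec dot (conv f comb) =
      conv f comb + (q - 1) • (comb - one)) : f = series q := by
  refine sub_eq_zero.mp (eq_zero_of_succ_comb_shift_add hq ?_ ?_)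
  · rw [Pi.sub_apply, hf, zero_sub, neg_eq_zero]
    rfl
  · simp only [map_sub, LinearMap.sub_apply]
    linear_combination h - series_equation (qInt_ne_zero hq)

/-- The positions of the letters `true` of a word, counted from `1`: if the word of the inner leaves
of a tree is given, these are the descents. -/
def positions (w : List Bool) : Finset ℕ :=
  (Finset.Ioo 0 (w.length + 1)).filter fun i => (true :: w)[i]? = some true

theorem positions_append_singleton (w : List Bool) (x : Bool) :
    positions (w ++ [x]) = if x then insert (w.length + 1) (positions w) else positions w := by
  have hget (i : ℕ) : (true :: (w ++ [x]))[i]? =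
      if i < w.length + 1 then (true :: w)[i]? else [x][i - (w.length + 1)]? := by
    rw [← List.cons_append, List.getElem?_append, List.length_cons]
  ext i
  rcases lt_trichotomy i (w.length + 1) with hi | rfl | hi
  · cases x <;>
      simp [positions, hget, hi.ne, show i < w.length + 1 + 1 by omega,
        show i ≤ w.length by omega]
  · cases x <;> simp [positions, hget]
  · cases x <;>
      simp [positions, hget, hi.ne', hi.not_gt, show ¬ i < w.length + 1 + 1 by omega]

theorem notMem_positions (w : List Bool) : w.length + 1 ∉ positions w := by
  simp [positions]

theorem card_positions (w : List Bool) : (positions w).card = w.count true := by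
  induction w using List.reverseRecOn with
  | nil => rfl
  | append_singleton w x ih =>
    rw [positions_append_singleton]
    cases x with
    | true => rw [if_pos rfl, Finset.card_insert_of_notMem (notMem_positions w), ih]; simp
    | false => simpa using ih

theorem sum_positions (w : List Bool) :
    ∑ i ∈ positions w, i = inv w + (w.count true + 1).choose 2 := by
  induction w using List.reverseRecOn with
  | nil => rfl
  | append_singleton w x ih =>
    rw [positions_append_singleton]
    cases x with
    | true =>
      have hlength := List.count_true_add_count_false w
      rw [if_pos rfl, Finset.sum_insert (notMem_positions w), ih, inv_append_true,
        List.count_append, List.count_singleton_self, Nat.choose_succ_succ' (w.count true + 1) 1,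
        Nat.choose_one_right, one_add_one_eq_two]
      omega
    | false => simpa [inv_append_false] using ih

theorem leaves_eq_word_append (t : PBT) : t.leaves = word t.toTree ++ [false] :=
  leafSides_false t.toTree

section Descents

variable {t : PBT} {w : List Bool} (hw : word t.toTree = true :: w)

include hw

theorem deg_eq_length_add_one : t.deg = w.length + 1 := by
  rw [PBT.deg, ← length_word, hw, List.length_cons]

theorem descents_eq_positions : t.descents = positions w := by
  rw [PBT.descents, positions, deg_eq_length_add_one hw]
  refine Finset.filter_congr fun i hi => ?_
  rw [leaves_eq_word_append, hw, List.getElem?_append_left (Finset.mem_Ioo.mp hi).2]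

theorem d_eq_count : t.d = w.count true := by
  rw [PBT.d, descents_eq_positions hw, card_positions]

theorem maj_eq_inv_add_choose : t.maj = inv w + (w.count true + 1).choose 2 := by
  rw [PBT.maj, descents_eq_positions hw, sum_positions]

end Descents

theorem series_toTree (q : K) (t : PBT) :
    series q t.toTree = (-1) ^ (t.deg - 1) / qInt q t.deg *
      ((-1) ^ t.d * (qBinom q (t.deg - 1) t.d)⁻¹ *
        q ^ ((t.maj : ℤ) - ((t.d + 1).choose 2 : ℤ))) := by
  obtain ⟨w, hw⟩ := exists_word_node () t.left t.right
  have hsign : ((-1 : K) ^ w.count true) * (-1) ^ w.count true = 1 := by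
    rw [← mul_pow, neg_one_mul, neg_neg, one_pow]
  rw [series, Function.comp_apply, PBT.toTree, hw, fullWeight, weight,
    ← inv_qInt_mul_qBinom_inv, deg_eq_length_add_one hw, d_eq_count hw, maj_eq_inv_add_choose hw,
    ← List.count_true_add_count_false w, Nat.add_sub_cancel, Nat.cast_add, add_sub_cancel_right,
    zpow_natCast, pow_add, div_eq_mul_inv]
  linear_combination (-(-1) ^ w.count false * q ^ inv w *
    (qInt q (w.count true + w.count false + 1))⁻¹ *
      (qBinom q (w.count true + w.count false) (w.count true))⁻¹) * hsign

end LeafWord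

/-! ### The embedding of `Dend` into its completion -/

namespace Dend

open BinaryTree (nil node numNodes)

variable {R : Type*} [CommRing R]

/-- The embedding of `Dend` into its completion, given by the coefficients of the trees. -/
def coeffs : Dend R →ₗ[R] TreeSeries R where
  toFun x
    | nil => 0
    | node _ l r => (show PBT →₀ R from x) ⟨l, r⟩
  map_add' _ _ := funext fun | nil => (add_zero 0).symm | node _ _ _ => rfl
  map_smul' c _ := funext fun | nil => (mul_zero c).symm | node _ _ _ => rfl

theorem coeffs_nil (x : Dend R) : coeffs x nil = 0 := rfl

theorem coeffs_injective : Function.Injective (coeffs (R := R)) :=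
  fun x y h => Finsupp.ext (f := x) (g := y) fun t => congrFun h t.toTree

theorem coeffs_tree (t : PBT) : coeffs (tree R t) = Pi.single t.toTree 1 := by
  funext u
  cases u with
  | nil => rfl
  | node x l r =>
    classical
    change Finsupp.single t (1 : R) ⟨l, r⟩ = _
    rw [Finsupp.single_apply, Pi.single_apply]
    exact if_congr (eq_comm.trans PBT.toTree_injective.eq_iff.symm) rfl rfl

theorem coeffs_sumTrees (m : Multiset PBT) :
    coeffs (sumTrees R m) = (m.map fun t => (Pi.single t.toTree 1 : TreeSeries R)).sum := by
  simp only [sumTrees, map_multiset_sum, Multiset.map_map, Function.comp_def, coeffs_tree]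

theorem eq_sum_tree_of_coeffs_eq_zero {x : Dend R} {n : ℕ}
    (hx : ∀ u, numNodes u ≠ n → coeffs x u = 0) :
    x = ∑ t ∈ PBT.ofDeg n, coeffs x t.toTree • tree R t := by
  apply coeffs_injective
  funext u
  simp only [map_sum, map_smul, coeffs_tree, Finset.sum_apply, Pi.smul_apply, Pi.single_apply,
    smul_eq_mul, mul_ite, mul_one, mul_zero]
  cases u with
  | nil => simp [coeffs_nil, PBT.toTree]
  | node x l r =>
    rw [Finset.sum_eq_single ⟨l, r⟩]
    · exact (if_pos rfl).symm
    · exact fun t _ ht => if_neg fun h => ht (PBT.toTree_injective h.symm)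
    · exact fun ht => (if_pos rfl).trans (hx _ (mt PBT.mem_ofDeg.mpr ht))

theorem conv_single (a b : BinaryTree Unit) :
    TreeSeries.conv (Pi.single a 1) (Pi.single b 1) =
      ((PBT.star a b).map fun v => (Pi.single v 1 : TreeSeries R)).sum := by
  match a, b with
  | nil, b => simpa [PBT.star_nil_left, TreeSeries.one] using
    TreeSeries.one_conv (Pi.single b 1 : TreeSeries R)
  | node () l r, nil =>
    simpa [PBT.star_nil_right, TreeSeries.one] using
      TreeSeries.conv_one (Pi.single (node () l r) 1 : TreeSeries R)
  | node () l r, node () l' r' =>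
    have hleft := conv_single r (node () l' r')
    have hright := conv_single (node () l r) l'
    funext u
    simp only [PBT.star_node, Multiset.map_add, Multiset.sum_add, Multiset.map_map,
      Function.comp_def, Pi.multiset_sum_apply]
    cases u with
    | nil => simp [TreeSeries.conv_nil]
    | node x p m =>
      rw [TreeSeries.conv_node, TreeSeries.single_node_comp_left,
        TreeSeries.single_node_comp_right, map_smul, map_smul, LinearMap.smul_apply, hleft, hright]
      simp only [TreeSeries.single_node_apply, Pi.smul_apply, Pi.multiset_sum_apply,
        Multiset.sum_map_mul_left, Multiset.sum_map_mul_right, Multiset.map_map,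
        Function.comp_def, smul_eq_mul]
      ring
termination_by a.numNodes + b.numNodes
decreasing_by all_goals simp only [numNodes]; omega

theorem linearMap_ext {M : Type*} [AddCommGroup M] [Module R M] {f g : Dend R →ₗ[R] M}
    (h : ∀ t, f (tree R t) = g (tree R t)) : f = g := by
  ext x
  induction x using Dend.induction with
  | zero => rw [map_zero, map_zero]
  | add a b ha hb => rw [map_add, map_add, ha, hb]
  | smul c t => rw [map_smul, map_smul, h]

theorem coeffs_prec (x y : Dend R) :
    coeffs (prec R x y) = TreeSeries.prec (coeffs x) (coeffs y) := by
  suffices h : (prec R).compr₂ coeffs = TreeSeries.prec.compl₁₂ coeffs coeffs from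
    LinearMap.congr_fun₂ h x y
  refine linearMap_ext fun t => linearMap_ext fun s => funext fun u => ?_
  simp only [LinearMap.compr₂_apply, LinearMap.compl₁₂_apply, prec, bilin_tree, coeffs_sumTrees,
    coeffs_tree, PBT.prec, Multiset.map_map, Function.comp_def, Pi.multiset_sum_apply]
  cases u with
  | nil => simp [TreeSeries.prec_nil, PBT.toTree]
  | node z p m =>
    rw [TreeSeries.prec_node, PBT.toTree.eq_1 t, TreeSeries.single_node_comp_right, map_smul,
      LinearMap.smul_apply, conv_single]
    simp [PBT.toTree, TreeSeries.single_node_apply, Multiset.sum_map_mul_left,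
      Pi.multiset_sum_apply]

theorem coeffs_succ (x y : Dend R) :
    coeffs (succ R x y) = TreeSeries.succ (coeffs x) (coeffs y) := by
  suffices h : (succ R).compr₂ coeffs = TreeSeries.succ.compl₁₂ coeffs coeffs from
    LinearMap.congr_fun₂ h x y
  refine linearMap_ext fun t => linearMap_ext fun s => funext fun u => ?_
  simp only [LinearMap.compr₂_apply, LinearMap.compl₁₂_apply, succ, bilin_tree, coeffs_sumTrees,
    coeffs_tree, PBT.succ, Multiset.map_map, Function.comp_def, Pi.multiset_sum_apply]
  cases u with
  | nil => simp [TreeSeries.succ_nil, PBT.toTree]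
  | node z p m =>
    rw [TreeSeries.succ_node, PBT.toTree, PBT.toTree, TreeSeries.single_node_comp_left, map_smul,
      conv_single]
    simp [PBT.toTree, TreeSeries.single_node_apply, Multiset.sum_map_mul_right,
      Pi.multiset_sum_apply, mul_comm]

theorem coeffs_mul (x y : Dend R) :
    coeffs (x * y) = TreeSeries.graftBy (coeffs y) (coeffs x) := by
  rw [mul_def, map_sub, coeffs_succ, coeffs_prec, TreeSeries.graftBy_apply]

end Dend

/-! ### Recursion on the degree in the completion -/

theorem existsUnique_fixedPoint_of_causal {M : ℕ → Type*} [∀ n, Nonempty (M n)]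
    (F : (∀ n, M n) → ∀ n, M n) (hF : ∀ A B n, (∀ m < n, A m = B m) → F A n = F B n) :
    ∃! A, F A = A := by
  let extendBelow (n : ℕ) (A : ∀ m < n, M m) : ∀ m, M m :=
    fun m => if hm : m < n then A m hm else Classical.arbitrary (M m)
  have extendBelow_apply (A : ∀ n, M n) {m n : ℕ} (hm : m < n) :
      extendBelow n (fun m _ => A m) m = A m := dif_pos hm
  let fixedPoint (n : ℕ) : M n := n.strongRec fun n A => F (extendBelow n A) n
  have fixedPoint_eq (n : ℕ) : fixedPoint n = F (extendBelow n fun m _ => fixedPoint m) n :=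
    Nat.strongRec_eq ..
  refine ⟨fixedPoint, funext fun n => ?_, fun B hB => funext fun n => ?_⟩
  · rw [fixedPoint_eq]
    exact hF _ _ _ fun m hm => (extendBelow_apply fixedPoint hm).symm
  · induction n using Nat.strongRecOn with
    | ind n ih =>
      rw [← hB, fixedPoint_eq]
      exact hF _ _ _ fun m hm => (ih m hm).trans (extendBelow_apply fixedPoint hm).symm

namespace PLHat

section Recursion

variable {R : Type*} [CommRing R] {A A' B B' T T' : PLHat R} {n : ℕ}

theorem homog_zero : PL.homog R 0 = ⊥ := by
  rw [PL.homog, Submodule.span_eq_bot]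
  rintro _ ⟨w, hw, rfl⟩
  exact absurd hw w.length_pos.ne'

theorem apply_zero (A : PLHat R) : A 0 = 0 :=
  Subtype.ext ((Submodule.mem_bot R).mp (homog_zero.le (A 0).2))

theorem coe_graft (A B : PLHat R) (n : ℕ) : (graft A B n : PL R) =
    ∑ p ∈ Finset.HasAntidiagonal.antidiagonal n, (A p.1 : PL R) * (B p.2 : PL R) := rfl

theorem coe_act (A : PLHat R) (f : PowerSeries R) (T : PLHat R) (n : ℕ) :
    (act A f T n : PL R) = ∑ k ∈ Finset.range (n + 1),
      PowerSeries.coeff k f • (((fun B => graft B T)^[k] A) n : PL R) := by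
  rw [act, Submodule.coe_sum]
  rfl

theorem graft_congr (hA : ∀ m < n, A m = A' m) (hB : ∀ m < n, B m = B' m) :
    graft A B n = graft A' B' n := by
  apply Subtype.ext
  rw [coe_graft, coe_graft]
  refine Finset.sum_congr rfl fun ⟨i, j⟩ hij => ?_
  have hij : i + j = n := Finset.HasAntidiagonal.mem_antidiagonal.mp hij
  rcases Nat.eq_zero_or_pos i with rfl | hi
  · simp [apply_zero]
  rcases Nat.eq_zero_or_pos j with rfl | hj
  · simp [apply_zero]
  rw [hA i (by omega), hB j (by omega)]

theorem iterate_graft_congr (hA : ∀ m < n, A m = A' m) (hT : ∀ m < n, T m = T' m) (k : ℕ) :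
    ((fun B => graft B T)^[k + 1] A) n = ((fun B => graft B T')^[k + 1] A') n := by
  induction k generalizing n with
  | zero => exact graft_congr hA hT
  | succ k ih =>
    rw [Function.iterate_succ_apply', Function.iterate_succ_apply' _ _ A']
    exact graft_congr
      (fun m hm => ih (fun i hi => hA i (hi.trans hm)) fun i hi => hT i (hi.trans hm)) hT

theorem act_congr {f : PowerSeries R} (hAf : PowerSeries.coeff 0 f • A n =
    PowerSeries.coeff 0 f • A' n) (hA : ∀ m < n, A m = A' m) (hT : ∀ m < n, T m = T' m) :
    act A f T n = act A' f T' n := by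
  refine Finset.sum_congr rfl fun k _ => ?_
  cases k with
  | zero => exact hAf
  | succ k => rw [iterate_graft_congr hA hT]

theorem existsUnique_isOmega : ∃! Ω : PLHat ℚ, IsOmega Ω :=
  existsUnique_fixedPoint_of_causal (act (gen ℚ) (bernoulliPowerSeries ℚ))
    fun _ _ _ h => act_congr rfl (fun _ _ => rfl) h

variable {K : Type*} [Field K] [Algebra ℚ K] {q : K}

theorem existsUnique_isOmegaQ (hq : ∀ n, q ^ (n + 1) ≠ 1) (Ω : PLHat ℚ) :
    ∃! Ωq : PLHat K, IsOmegaQ q Ω Ωq := by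
  -- In degree `n` the equation reads `(qⁿ - 1) Ω_{q,n} = …` with the right side of lower degree.
  let F (A : PLHat K) : PLHat K := fun n => (q ^ n - 1)⁻¹ • (graft (gen K) A n +
    (q - 1) • gen K n - act (qShift q A) (PowerSeries.exp K - 1) (extend K Ω) n)
  have fixedPoint_iff (A : PLHat K) : F A = A ↔ IsOmegaQ q Ω A := by
    rw [IsOmegaQ, funext_iff, funext_iff]
    refine forall_congr' fun n => ?_
    rcases n with - | n
    · simp only [apply_zero]
    · have hn : q ^ (n + 1) - 1 ≠ 0 := sub_ne_zero.mpr (hq n)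
      simp only [F, Pi.add_apply, Pi.sub_apply, Pi.smul_apply, qShift]
      rw [inv_smul_eq_iff₀ hn, sub_smul (q ^ (n + 1)), one_smul, sub_eq_iff_eq_add,
        add_sub_assoc, eq_comm, add_comm (act _ _ _ _)]
  simp only [← fixedPoint_iff]
  refine existsUnique_fixedPoint_of_causal F fun A B n h => ?_
  have hact : act (qShift q A) (PowerSeries.exp K - 1) (extend K Ω) n =
      act (qShift q B) (PowerSeries.exp K - 1) (extend K Ω) n :=
    act_congr (by simp) (fun m hm => by rw [qShift, qShift, h m hm]) fun _ _ => rfl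
  simp only [F, graft_congr (fun _ _ => rfl) h, hact]

end Recursion

/-! ### Extension of scalars -/

section Extend

variable {R : Type*} [CommRing R] [Algebra ℚ R]

theorem rat_smul_eq (c : ℚ) (x : PL R) : c • x = algebraMap ℚ R c • x := by
  obtain ⟨z, rfl⟩ := Quot.mk_surjective x
  exact congrArg (Quot.mk _) (algebraMap_smul R c z).symm

theorem coe_extend (A : PLHat ℚ) (n : ℕ) :
    (extend R A n : PL R) = PL.extend R (A n : PL ℚ) := rfl

theorem extend_gen : extend R (gen ℚ) = gen R := by
  funext n
  apply Subtype.ext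
  rw [coe_extend]
  rcases eq_or_ne n 1 with rfl | hn
  · simp only [gen, Pi.single_eq_same]
    exact FreePreLie.lift_of _ _
  · simp [gen, hn]

theorem extend_graft (A B : PLHat ℚ) :
    extend R (graft A B) = graft (extend R A) (extend R B) := by
  funext n
  apply Subtype.ext
  simp only [coe_extend, coe_graft, map_sum, map_mul]

theorem extend_iterate (A T : PLHat ℚ) (k : ℕ) :
    extend R ((fun B => graft B T)^[k] A) = (fun B => graft B (extend R T))^[k] (extend R A) :=
  Function.Semiconj.iterate_right (fun B => extend_graft B T) k A

theorem extend_act (A : PLHat ℚ) (f : PowerSeries ℚ) (T : PLHat ℚ) :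
    extend R (act A f T) = act (extend R A) (f.map (algebraMap ℚ R)) (extend R T) := by
  funext n
  apply Subtype.ext
  rw [coe_extend, coe_act, coe_act, map_sum]
  refine Finset.sum_congr rfl fun k _ => ?_
  rw [map_smul, rat_smul_eq, PowerSeries.coeff_map, ← extend_iterate, coe_extend]

theorem map_bernoulliPowerSeries :
    (bernoulliPowerSeries ℚ).map (algebraMap ℚ R) = bernoulliPowerSeries R := by
  ext n
  simp [bernoulliPowerSeries]

theorem act_bernoulliPowerSeries_extend {Ω : PLHat ℚ} (hΩ : IsOmega Ω) :
    act (gen R) (bernoulliPowerSeries R) (extend R Ω) = extend R Ω := by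
  rw [← extend_gen, ← map_bernoulliPowerSeries, ← extend_act, hΩ]

theorem act_exp_sub_one_add (A T : PLHat R) :
    act A (PowerSeries.exp R - 1) T + A = act A (PowerSeries.exp R) T := by
  funext n
  simp only [Pi.add_apply, act]
  rw [Finset.sum_range_succ', Finset.sum_range_succ' _ n]
  simp [PowerSeries.coeff_one]

end Extend

end PLHat

/-! ### The image of the completion under `φ` -/

namespace PLHat

open TreeSeries
open BinaryTree (nil numNodes)

section ToSeries

variable {R : Type*} [CommRing R]

theorem coeffs_phi_of : Dend.coeffs (phi R (FreePreLie.of R ())) = dot := by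
  rw [phi, FreePreLie.lift_of, Dend.coeffs_tree]
  rfl

theorem coeffs_phi_monomial_eq_zero (w : FreeMagma Unit) {u : BinaryTree Unit}
    (hu : numNodes u ≠ w.length) :
    Dend.coeffs (phi R (FreeMagma.lift (FreePreLie.of R) w)) u = 0 := by
  induction w generalizing u with
  | ih1 x =>
    change Dend.coeffs (phi R (FreePreLie.of R ())) u = 0
    rw [coeffs_phi_of, dot, Pi.single_eq_of_ne]
    rintro rfl
    exact hu rfl
  | ih2 v w hv hw =>
    change numNodes u ≠ v.length + w.length at hu
    rw [map_mul, map_mul, Dend.coeffs_mul]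
    refine graftBy_eq_zero fun a b hab => ?_
    by_cases ha : numNodes a = v.length
    · exact .inr (hw (by omega))
    · exact .inl (hv ha)

theorem coeffs_phi_eq_zero {n : ℕ} {x : PL R} (hx : x ∈ PL.homog R n) {u : BinaryTree Unit}
    (hu : numNodes u ≠ n) : Dend.coeffs (phi R x) u = 0 := by
  induction hx using Submodule.span_induction with
  | zero => simp
  | add a b _ _ ha hb => rw [map_add, map_add, Pi.add_apply, ha, hb, add_zero]
  | smul c a _ ha => rw [map_smul, map_smul, Pi.smul_apply, ha, smul_zero]
  | mem a ha =>
    obtain ⟨w, rfl, rfl⟩ := ha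
    exact coeffs_phi_monomial_eq_zero w hu

/-- The extension of `φ` to the completions, given by the coefficients of the trees: those of the
trees with `n` vertices come from the component of degree `n`. -/
def toSeries : PLHat R →ₗ[R] TreeSeries R where
  toFun A u := Dend.coeffs (phi R (A (numNodes u) : PL R)) u
  map_add' A B := by
    funext u
    simp only [Pi.add_apply, Submodule.coe_add, map_add]
  map_smul' c A := by
    funext u
    simp only [Pi.smul_apply, Submodule.coe_smul, map_smul, RingHom.id_apply]

theorem toSeries_apply (A : PLHat R) (u : BinaryTree Unit) :
    toSeries A u = Dend.coeffs (phi R (A (numNodes u) : PL R)) u := rfl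

theorem toSeries_nil (A : PLHat R) : toSeries A nil = 0 := rfl

theorem toSeries_apply_eq_sum (A : PLHat R) {u : BinaryTree Unit} {N : ℕ} (hu : numNodes u < N) :
    toSeries A u = (∑ i ∈ Finset.range N, Dend.coeffs (phi R (A i : PL R))) u := by
  rw [toSeries_apply, Finset.sum_apply, Finset.sum_eq_single (numNodes u)]
  · exact fun i _ hi => coeffs_phi_eq_zero (A i).2 hi.symm
  · exact fun h => absurd (Finset.mem_range.mpr hu) h

theorem toSeries_graft (A B : PLHat R) :
    toSeries (graft A B) = graftBy (toSeries B) (toSeries A) := by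
  funext u
  have truncate (C : PLHat R) (a : BinaryTree Unit) (ha : numNodes a ≤ numNodes u) :=
    toSeries_apply_eq_sum C (Nat.lt_succ_of_le ha)
  rw [graftBy_congr (truncate B) (truncate A), toSeries_apply, coe_graft]
  simp only [map_sum, map_mul, Dend.coeffs_mul, LinearMap.sum_apply, Finset.sum_apply]
  rw [← Finset.sum_product']
  refine Finset.sum_subset (fun p hp => ?_) fun p _ hp => ?_
  · have := Finset.HasAntidiagonal.mem_antidiagonal.mp hp
    exact Finset.mem_product.mpr
      ⟨Finset.mem_range.mpr (by omega), Finset.mem_range.mpr (by omega)⟩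
  · refine graftBy_eq_zero fun a b hab => ?_
    rw [Finset.HasAntidiagonal.mem_antidiagonal, ← hab] at hp
    by_cases ha : numNodes a = p.1
    · exact .inr (coeffs_phi_eq_zero (B p.2).2 (by omega))
    · exact .inl (coeffs_phi_eq_zero (A p.1).2 ha)

theorem toSeries_iterate (A T : PLHat R) (k : ℕ) :
    toSeries ((fun B => graft B T)^[k] A) = (graftBy (toSeries T) ^ k) (toSeries A) := by
  rw [Module.End.pow_apply]
  exact Function.Semiconj.iterate_right (fun B => toSeries_graft B T) k A

theorem toSeries_act (A T : PLHat R) (c : PowerSeries R) :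
    toSeries (act A c T) = powerEval numNodes c (graftBy (toSeries T)) (toSeries A) := by
  funext u
  simp only [powerEval_apply, ← toSeries_iterate]
  rw [toSeries_apply, coe_act]
  simp [toSeries_apply]

theorem toSeries_gen : toSeries (gen R) = dot := by
  funext u
  rw [toSeries_apply]
  by_cases hu : numNodes u = 1
  · rw [hu, gen, Pi.single_eq_same, coeffs_phi_of]
  · rw [gen, Pi.single_eq_of_ne hu, ZeroMemClass.coe_zero, map_zero, map_zero, dot,
      Pi.single_eq_of_ne (by rintro rfl; exact hu rfl), Pi.zero_apply]

theorem toSeries_qShift (q : R) (A : PLHat R) :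
    toSeries (qShift q A) = shift q (toSeries A) := by
  funext u
  rw [toSeries_apply, qShift, Submodule.coe_smul, map_smul, map_smul, shift_apply]
  rfl

end ToSeries

variable {K : Type*} [Field K] [Algebra ℚ K] {q : K} {Ω : PLHat ℚ} {Ωq : PLHat K}

theorem exp_graftBy_toSeries_prec_comb (hΩ : IsOmega Ω) {f : TreeSeries K} (hf : f nil = 0) :
    prec (powerEval numNodes (PowerSeries.exp K) (graftBy (toSeries (extend K Ω))) f) comb =
      succ comb f :=
  exp_graftBy_prec_comb (toSeries_nil _)
    (by rw [← toSeries_gen, ← toSeries_act, act_bernoulliPowerSeries_extend hΩ]) hf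

theorem toSeries_equation (hΩ : IsOmega Ω) (hΩq : IsOmegaQ q Ω Ωq) :
    succ comb (shift q (toSeries Ωq)) + prec dot (conv (toSeries Ωq) comb) =
      conv (toSeries Ωq) comb + (q - 1) • (comb - one) := by
  have himage : powerEval numNodes (PowerSeries.exp K) (graftBy (toSeries (extend K Ω)))
      (shift q (toSeries Ωq)) - toSeries Ωq = graftBy (toSeries Ωq) dot + (q - 1) • dot := by
    rw [IsOmegaQ, act_exp_sub_one_add] at hΩq
    simpa only [map_sub, map_add, map_smul, toSeries_act, toSeries_qShift, toSeries_graft,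
      toSeries_gen] using congrArg toSeries hΩq
  have hcomb : prec dot comb = comb - one (R := K) :=
    eq_sub_of_add_eq' comb_eq_one_add_dot_prec_comb.symm
  have hgraft : prec (graftBy (toSeries Ωq) dot) comb =
      succ (toSeries Ωq) comb - prec dot (conv (toSeries Ωq) comb) := by
    rw [graftBy_apply, map_sub, LinearMap.sub_apply, ← succ_prec, hcomb, map_sub, succ_one,
      sub_zero, prec_conv]
  have hprec := congrArg (prec · comb) himage
  simp only [map_sub, map_add, map_smul, LinearMap.sub_apply, LinearMap.add_apply,
    LinearMap.smul_apply] at hprec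
  rw [exp_graftBy_toSeries_prec_comb hΩ (by rw [shift_apply, toSeries_nil, mul_zero]), hgraft,
    hcomb, sub_eq_iff_eq_add] at hprec
  rw [hprec, conv_eq_succ_add_prec (by rw [toSeries_nil, zero_mul])]
  abel

theorem toSeries_eq_series (hq : ∀ n, q ^ (n + 1) ≠ 1) (hΩ : IsOmega Ω)
    (hΩq : IsOmegaQ q Ω Ωq) : toSeries Ωq = LeafWord.series q :=
  LeafWord.eq_series hq (toSeries_nil Ωq) (toSeries_equation hΩ hΩq)

theorem phi_apply_eq_sum (hq : ∀ n, q ^ (n + 1) ≠ 1) (hΩ : IsOmega Ω)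
    (hΩq : IsOmegaQ q Ω Ωq) (n : ℕ) :
    phi K (Ωq n : PL K) = ((-1 : K) ^ (n - 1) / qInt q n) • ∑ t ∈ PBT.ofDeg n,
      ((-1 : K) ^ t.d * (qBinom q (n - 1) t.d)⁻¹ * q ^ ((t.maj : ℤ) - ((t.d + 1).choose 2 : ℤ))) •
        Dend.tree K t := by
  rw [Dend.eq_sum_tree_of_coeffs_eq_zero fun u => coeffs_phi_eq_zero (Ωq n).2, Finset.smul_sum]
  refine Finset.sum_congr rfl fun t ht => ?_
  obtain rfl : t.deg = n := PBT.mem_ofDeg.mp ht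
  rw [smul_smul, ← LeafWord.series_toTree, ← toSeries_eq_series hq hΩ hΩq]
  rfl

end PLHat

theorem ratFunc_X_pow_ne_one (n : ℕ) : (RatFunc.X : RatFunc ℚ) ^ (n + 1) ≠ 1 := by
  intro h
  rw [← RatFunc.algebraMap_X, ← map_pow, ← map_one (algebraMap (Polynomial ℚ) (RatFunc ℚ))] at h
  simpa using congrArg Polynomial.natDegree (RatFunc.algebraMap_injective ℚ h)

theorem mainTheorem2_general {K : Type*} [Field K] [Algebra ℚ K] {q : K}
    (hq : ∀ n : ℕ, q ^ (n + 1) ≠ 1) :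
    ∃ Ω : PLHat ℚ, (IsOmega Ω ∧ ∀ Ω' : PLHat ℚ, IsOmega Ω' → Ω' = Ω) ∧
    ∃ Ωq : PLHat K,
      (IsOmegaQ q Ω Ωq ∧ ∀ Ωq' : PLHat K, IsOmegaQ q Ω Ωq' → Ωq' = Ωq) ∧
      ∀ n : ℕ, 1 ≤ n →
        phi K (Ωq n : PL K) =
          ((-1 : K) ^ (n - 1) / qInt q n) •
            ∑ t ∈ PBT.ofDeg n,
              ((-1 : K) ^ t.d * (qBinom q (n - 1) t.d)⁻¹ *
                q ^ ((t.maj : ℤ) - ((t.d + 1).choose 2 : ℤ))) •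
              Dend.tree K t := by
  obtain ⟨Ω, hΩ, hΩ_unique⟩ := PLHat.existsUnique_isOmega
  obtain ⟨Ωq, hΩq, hΩq_unique⟩ := PLHat.existsUnique_isOmegaQ hq Ω
  exact ⟨Ω, ⟨hΩ, hΩ_unique⟩, Ωq, ⟨hΩq, hΩq_unique⟩,
    fun n _ => PLHat.phi_apply_eq_sum hq hΩ hΩq n⟩

end

theorem mainTheorem2 :
    ∃ Ω : PLHat ℚ, (IsOmega Ω ∧ ∀ Ω' : PLHat ℚ, IsOmega Ω' → Ω' = Ω) ∧
    ∃ Ωq : PLHat (RatFunc ℚ),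
      (IsOmegaQ RatFunc.X Ω Ωq ∧
        ∀ Ωq' : PLHat (RatFunc ℚ), IsOmegaQ RatFunc.X Ω Ωq' → Ωq' = Ωq) ∧
      ∀ n : ℕ, 1 ≤ n →
        phi (RatFunc ℚ) (Ωq n : PL (RatFunc ℚ)) =
          ((-1 : RatFunc ℚ) ^ (n - 1) / qInt RatFunc.X n) •
            ∑ t ∈ PBT.ofDeg n,
              ((-1 : RatFunc ℚ) ^ t.d * (qBinom RatFunc.X (n - 1) t.d)⁻¹ *
                (RatFunc.X : RatFunc ℚ) ^ ((t.maj : ℤ) - ((t.d + 1).choose 2 : ℤ))) •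
              Dend.tree (RatFunc ℚ) t := by
  exact mainTheorem2_general ratFunc_X_pow_ne_one
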